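/- All simplicial complexes are finite and non-empty, and their faces are non-empty. A simplicial complex $K$ is $\mathbb{Z}_2$-acyclic if its reduced (simplicial) homology $\widetilde H_q(K;\mathbb{Z}_2)\cong\widetilde H_q(|K|;\mathbb{Z}_2)$ vanishes for all $q\ge 0$. If $\tau\subsetneq\sigma$ are faces of $K$ such that $\sigma$ is the only face of $K$ properly containing $\tau$, then passing from $K$ to $K\setminus\{\tau,\sigma\}$ is an elementary collapse; $K$ is collapsible if a finite (possibly empty) sequence of elementary collapses leads from $K$ to a complex consisting of a single vertex. The Dunce Hat is the topological space obtained from a solid triangle $abc$ by identifying the oriented edges $\vec{ab}$, $\vec{bc}$ and $\vec{ac}$ (that is, the points $(1-t)a+tb$, $(1-t)b+tc$ and $(1-t)a+tc$ are identified for each $t\in[0,1]$). Theorem. Every $\mathbb{Z}_2$-acyclic simplicial complex with at most $7$ vertices is collapsible. The bound $7$ is sharp: there is a simplicial complex with exactly $8$ vertices whose geometric carrier is homeomorphic to the Dunce Hat and which is $\mathbb{Z}_2$-acyclic but not collapsible. -/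

import Mathlib

namespace PreAbstractSimplicialComplex

/-- The vertex set of a simplicial complex: the points `v` such that `{v}` is a face. (The ambient
type may contain further points, which are irrelevant.) -/
def vertexSet {V : Type*} (K : PreAbstractSimplicialComplex V) : Set V :=
  {v | {v} ∈ K.faces}

/-! ### Simplicial homology with coefficients in `ℤ/2` -/

/-- The module of chains of `K` over `ℤ/2` spanned by the faces with exactly `n` vertices, that is,
by the faces of dimension `n - 1`. The empty simplex is used for `n = 0`, which makes the
resulting chain complex the augmented one. -/
def chains {V : Type*} (K : PreAbstractSimplicialComplex V) (n : ℕ) :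
    Submodule (ZMod 2) (Finset V →₀ ZMod 2) :=
  Finsupp.supported (ZMod 2) (ZMod 2) {s | s.card = n ∧ (s = ∅ ∨ s ∈ K.faces)}

/-- The simplicial boundary over `ℤ/2`: a simplex is sent to the sum of its codimension one faces.
No signs are needed over `ℤ/2`. On a vertex it is the augmentation. -/
noncomputable def boundary (V : Type*) [DecidableEq V] :
    (Finset V →₀ ZMod 2) →ₗ[ZMod 2] (Finset V →₀ ZMod 2) :=
  Finsupp.linearCombination (ZMod 2) fun s : Finset V => ∑ v ∈ s, Finsupp.single (s.erase v) 1

/-- The (reduced) `q`-cycles of `K` over `ℤ/2`. -/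
noncomputable def cycles {V : Type*} [DecidableEq V] (K : PreAbstractSimplicialComplex V) (q : ℕ) :
    Submodule (ZMod 2) (Finset V →₀ ZMod 2) :=
  K.chains (q + 1) ⊓ LinearMap.ker (boundary V)

/-- The `q`-boundaries of `K` over `ℤ/2`. -/
noncomputable def boundaries {V : Type*} [DecidableEq V] (K : PreAbstractSimplicialComplex V)
    (q : ℕ) : Submodule (ZMod 2) (Finset V →₀ ZMod 2) :=
  (K.chains (q + 2)).map (boundary V)

theorem boundary_single {V : Type*} [DecidableEq V] (s : Finset V) :
    boundary V (Finsupp.single s 1) = ∑ v ∈ s, Finsupp.single (s.erase v) 1 := by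
  simp [boundary]

theorem boundary_boundary {V : Type*} [DecidableEq V] (c : Finset V →₀ ZMod 2) :
    boundary V (boundary V c) = 0 := by
  suffices h : (boundary V).comp (boundary V) = 0 from LinearMap.congr_fun h c
  refine Finsupp.lhom_ext' fun s => LinearMap.ext_ring ?_
  simp only [LinearMap.comp_apply, Finsupp.lsingle_apply, LinearMap.zero_apply,
    boundary_single, map_sum]
  rw [Finset.sum_sigma']
  refine Finset.sum_involution (fun p _ => ⟨p.2, p.1⟩) ?_ ?_ ?_ ?_
  · rintro ⟨v, w⟩ _
    simp only [Finset.erase_right_comm (a := w) (b := v), ← Finsupp.single_add]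
    rw [CharTwo.add_self_eq_zero, Finsupp.single_zero]
  · rintro ⟨v, w⟩ h _ heq
    simp only [Finset.mem_sigma, Finset.mem_erase] at h
    simp only [Sigma.mk.injEq] at heq
    exact h.2.1 heq.1
  · rintro ⟨v, w⟩ h
    simp only [Finset.mem_sigma, Finset.mem_erase] at h ⊢
    exact ⟨h.2.2, fun e => h.2.1 e.symm, h.1⟩
  · rintro ⟨v, w⟩ _
    rfl

/-- Boundaries are cycles, so their quotient is the homology of a chain complex. -/
theorem boundaries_le_cycles {V : Type*} [DecidableEq V] (K : PreAbstractSimplicialComplex V)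
    (q : ℕ) : K.boundaries q ≤ K.cycles q := by
  rintro _ ⟨c, hc, rfl⟩
  refine ⟨?_, boundary_boundary c⟩
  simp only [boundary, Finsupp.linearCombination_apply, Finsupp.sum]
  refine Submodule.sum_mem _ fun s hs => Submodule.smul_mem _ _ (Submodule.sum_mem _ fun v hv => ?_)
  refine Finsupp.single_mem_supported _ _ ?_
  obtain ⟨h1, h2⟩ := (Finsupp.mem_supported _ _).1 hc hs
  have hcard : (s.erase v).card = q + 1 := by rw [Finset.card_erase_of_mem hv, h1]; rfl
  refine ⟨hcard, Or.inr ?_⟩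
  rcases h2 with rfl | h2
  · simp at hv
  · exact (K.isRelLowerSet_faces h2).2 (Finset.erase_subset v s)
      (Finset.card_pos.1 (by rw [hcard]; exact Nat.succ_pos q))

/-- `K` is `ℤ/2`-acyclic: the reduced simplicial homology (cycles modulo boundaries) of `K` with
coefficients in `ℤ/2` vanishes in all degrees `q ≥ 0`. -/
def IsAcyclic {V : Type*} [DecidableEq V] (K : PreAbstractSimplicialComplex V) : Prop :=
  ∀ q : ℕ, K.cycles q = K.boundaries q

/-! ### Collapsing -/

/-- `τ` is a free face of `σ` in `K`: `τ ⊂ σ` are faces of `K`, and `σ` is the only face of `K`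
that properly contains `τ`. -/
def IsFreeFace {V : Type*} (K : PreAbstractSimplicialComplex V) (τ σ : Finset V) : Prop :=
  τ ∈ K.faces ∧ σ ∈ K.faces ∧ τ ⊂ σ ∧ ∀ ρ ∈ K.faces, τ ⊂ ρ → ρ = σ

/-- There is an elementary collapse of `K` to `L`: `L = K \ {τ, σ}` for a free face `τ` of `σ`. -/
def ElementaryCollapse {V : Type*} (K L : PreAbstractSimplicialComplex V) : Prop :=
  ∃ τ σ : Finset V, K.IsFreeFace τ σ ∧ L.faces = K.faces \ {τ, σ}

/-- `K` collapses to `L`: there is a finite (possibly empty) sequence of elementary collapses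
from `K` to `L`. -/
def Collapses {V : Type*} (K L : PreAbstractSimplicialComplex V) : Prop :=
  Relation.ReflTransGen ElementaryCollapse K L

/-- `K` is collapsible: it collapses to a complex consisting of a single vertex. -/
def IsCollapsible {V : Type*} (K : PreAbstractSimplicialComplex V) : Prop :=
  ∃ (L : PreAbstractSimplicialComplex V) (v : V), K.Collapses L ∧ L.faces = {{v}}

/-! ### Geometric carrier and triangulations -/

/-- The geometric carrier `|K|` of a simplicial complex with finitely many vertices, in barycentric
coordinates: the points of the standard simplex on `V` that are supported on a face of `K`. It is
topologized as a subspace of `V → ℝ`. -/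
def carrier {V : Type*} [Fintype V] (K : PreAbstractSimplicialComplex V) : Set (V → ℝ) :=
  {x | x ∈ stdSimplex ℝ V ∧ ∃ s ∈ K.faces, Function.support x ⊆ (s : Set V)}

/-- `K` triangulates the topological space `X`: `X` is homeomorphic to `|K|`. -/
def Triangulates {V : Type*} [Fintype V] (K : PreAbstractSimplicialComplex V)
    (X : Type*) [TopologicalSpace X] : Prop :=
  Nonempty (K.carrier ≃ₜ X)

end PreAbstractSimplicialComplex

/-- The identifications that define the Dunce Hat, on the solid triangle `abc` in barycentric
coordinates: the points `(1 - t) a + t b`, `(1 - t) b + t c` and `(1 - t) a + t c` are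
identified, for each `t ∈ [0, 1]`. -/
inductive DunceHatRel : stdSimplex ℝ (Fin 3) → stdSimplex ℝ (Fin 3) → Prop
  | ab_bc (t : ℝ) (x y : stdSimplex ℝ (Fin 3)) (hx : (x : Fin 3 → ℝ) = ![1 - t, t, 0])
      (hy : (y : Fin 3 → ℝ) = ![0, 1 - t, t]) : DunceHatRel x y
  | ab_ac (t : ℝ) (x y : stdSimplex ℝ (Fin 3)) (hx : (x : Fin 3 → ℝ) = ![1 - t, t, 0])
      (hy : (y : Fin 3 → ℝ) = ![1 - t, 0, t]) : DunceHatRel x y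

/-- The Dunce Hat: the quotient (with the quotient topology) of a solid triangle `abc` obtained by
identifying the oriented edges `ab`, `bc` and `ac`. -/
abbrev DunceHat : Type :=
  Quot DunceHatRel

/-! Collapsibility is proved by induction on the number of faces. Let `d` be the dimension of an
acyclic complex, call its `d`-dimensional faces facets and the sets of `d` vertices inside them
ridges. If `d = 0`, acyclicity leaves a single vertex. If `d > 0` and some ridge lies in only one
facet, it is a free face, and collapsing it preserves acyclicity (`IsAcyclic.removeFree`). Otherwise
the facets form a rigid family: no ridge lies in exactly one of them, and, since nothing of higher
dimension can bound, no non-empty set of them is a cycle mod 2 (`IsAcyclic.eq_empty_of_even`).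

`not_isRigidFamily` rules out rigid families on seven vertices. The whole family is not a cycle, so
some ridge lies in an odd number of members, hence in at least three. After relabelling, the ridge
is `{0, …, d - 1}` and the three members add `d`, `d + 1`, `d + 2`; so `d ≤ 4`. For each `d` a
backtracking search run by the kernel finishes the proof: it takes a ridge used exactly once,
branches over a second member containing it, and discards candidates whose boundary depends on the
boundaries already chosen.

For sharpness, a disc with 14 vertices is glued to a Dunce Hat with 8 vertices and 17 triangles.
Every proper face lies in two triangles, so no collapse can start. Acyclicity reduces to the
invertibility of a `17 × 17` matrix over `ZMod 2`. The disc is shown to triangulate the triangle by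
means of a convex function that is linear exactly on its cells, and gluing is shown to make the same
identifications as `DunceHatRel`. -/

namespace RidgeSearch

/-! ### The search program, on matrices packed into natural numbers. -/

/-- Evaluates `n` to a numeral before passing it on, which only matters for the kernel's evaluation
order. -/
def force {α : Type} (n : ℕ) (k : ℕ → α) : α :=
  Nat.rec (k 0) (fun m _ => k (Nat.succ m)) n

def lowBit (n : ℕ) : ℕ := Nat.xor n (Nat.land n (Nat.sub n 1))

def pack (b : ℕ) (l : List ℕ) : ℕ := l.foldr (fun a M => Nat.add (Nat.mul b M) a) 0

def popCount (m : ℕ) : ℕ :=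
  (List.range 7).foldr (fun v a => Nat.add (Nat.land (Nat.div m (Nat.pow 2 v)) 1) a) 0

def masks (k : ℕ) : List ℕ := (List.range 128).filter fun m => Nat.beq (popCount m) k

def facetBoundary (d m : ℕ) : ℕ :=
  pack 2 ((masks d).map fun r => bif Nat.beq (Nat.land r m) r then 1 else 0)

/-- A row has 35 bits because `35 = C(7, 3) = C(7, 4)` is the largest number of subsets of one size;
it bounds both the ridges and the facets. -/
def rowMask : ℕ := 2 ^ 35 - 1

def colMask : ℕ := pack (2 ^ 35) (0 :: List.replicate 35 1)

/-- Bit `35 * i + r` records whether facet `i` contains ridge `r`. Facets are numbered from `1`; row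
`0` is scratch space that the search never reads. -/
def boundaryMatrix (d : ℕ) : ℕ := pack (2 ^ 35) (0 :: (masks (d + 1)).map (facetBoundary d))

/-- One step of Gaussian elimination on all rows at once: the pivot is the lowest bit of `row`, the
pivot column is shifted into place, and multiplication copies `row` into every row with a bit there.
-/
def eliminate (u M row : ℕ) : ℕ :=
  Nat.xor M (Nat.mul (Nat.lor 1 (Nat.land (Nat.div M (lowBit row)) u)) row)

/-- The candidates are the bits of `c`. A candidate with reduced row zero is dependent and is
skipped; any other is added and, once refuted, has its row cleared so that later branches exclude
it. The answer `true` certifies that no family exists, so running out of fuel with candidates left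
must give `false`. -/
def loop (D u w : ℕ) (next : ℕ → ℕ → ℕ → Bool) (one two n : ℕ) : ℕ → ℕ → Bool :=
  Nat.rec (fun _ c => Nat.beq c 0)
    (fun _ ih M c =>
      bif Nat.beq c 0 then true else
      (fun k => (fun row => (fun c' =>
        bif Nat.beq row 0 then ih M c' else
        bif (fun b => force (eliminate u M row) fun M' =>
            force (Nat.lor two (Nat.land one b)) fun two' =>
            force (Nat.lor one b) fun one' => next M' one' two') (Nat.land (Nat.div D k) w)
        then force (Nat.xor M (Nat.mul row (Nat.add 1 k))) fun M' => ih M' c'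
        else false) (Nat.xor c k)) (Nat.land (Nat.div M k) w)) (lowBit c)) n

/-- The bits of `one` xor `two` are the ridges used exactly once; if there is none, the search gives
up with `false`. Fuel `6` is enough for the inner loop, as a ridge with `d ≥ 1` vertices lies in `7
- d` facets. -/
def search (D u w n : ℕ) : ℕ → ℕ → ℕ → Bool :=
  Nat.rec (fun _ _ _ => false)
    (fun _ ih M one two =>
      force (Nat.xor one two) fun m =>
        bif Nat.beq m 0 then false
        else loop D u w ih one two 6 M (Nat.land (Nat.div D (lowBit m)) u)) n

def searchFrom (D u w : ℕ) : List ℕ → ℕ → ℕ → ℕ → Bool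
  | [], M, one, two => search D u w 30 M one two
  | f :: l, M, one, two =>
    (fun k => (fun row => (fun b =>
      force (eliminate u M row) fun M' => force (Nat.lor two (Nat.land one b)) fun two' =>
          force (Nat.lor one b) fun one' => searchFrom D u w l M' one' two')
       (Nat.land (Nat.div D k) w)) (Nat.land (Nat.div M k) w)) (Nat.pow 2 (Nat.mul 35 f))

def noFamilyContaining (d : ℕ) (l : List ℕ) : Bool :=
  force (boundaryMatrix d) fun D => force colMask fun u => force rowMask fun w =>
    searchFrom D u w (l.map ((0 :: masks (d + 1)).idxOf)) D 0 0

/-! ### Arithmetic of packed rows -/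

theorem force_eq {α : Type} (n : ℕ) (k : ℕ → α) : force n k = k n := by
  cases n <;> rfl

/-- The `i`-th row of a matrix that is packed into a natural number, `35` bits for each row. -/
def row (M i : ℕ) : ℕ := M / 2 ^ (35 * i) % 2 ^ 35

theorem testBit_row (M i r : ℕ) : (row M i).testBit r = (decide (r < 35) && M.testBit (35 * i + r)) := by
  rw [row, Nat.testBit_mod_two_pow, Nat.testBit_div_two_pow, add_comm r]

theorem row_xor (M N i : ℕ) : row (M ^^^ N) i = row M i ^^^ row N i := by
  refine Nat.eq_of_testBit_eq fun r => ?_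
  simp only [testBit_row, Nat.testBit_xor]
  cases decide (r < 35) <;> simp

theorem row_lt (M i : ℕ) : row M i < 2 ^ 35 := Nat.mod_lt _ (by positivity)

theorem row_zero (M : ℕ) : row M 0 = M % 2 ^ 35 := by simp [row]

theorem row_succ (M i : ℕ) : row M (i + 1) = row (M / 2 ^ 35) i := by
  rw [row, row, Nat.div_div_eq_div_mul, ← pow_add, mul_add, mul_one, add_comm 35]

theorem land_rowMask (x i : ℕ) : Nat.land (Nat.div x (2 ^ (35 * i))) rowMask = row x i :=
  Nat.and_two_pow_sub_one_eq_mod _ 35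

/-- Multiplying a packed column of bits by a row puts the row wherever the column has a bit. -/
theorem row_mul (s v i : ℕ) (hs : ∀ j, row s j ≤ 1) (hv : v < 2 ^ 35) :
    row (s * v) i = row s i * v := by
  have key : s * v = s % 2 ^ 35 * v + 2 ^ 35 * (s / 2 ^ 35 * v) := by
    conv_lhs => rw [← Nat.mod_add_div s (2 ^ 35)]
    ring
  have h0 : s % 2 ^ 35 * v < 2 ^ 35 := by
    have := hs 0
    rw [row_zero] at this
    nlinarith
  induction i generalizing s with
  | zero =>
    rw [row_zero, row_zero, key, Nat.add_mul_mod_self_left, Nat.mod_eq_of_lt h0]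
  | succ i ih =>
    rw [row_succ, row_succ, ← ih (s / 2 ^ 35) (fun j => by rw [← row_succ]; exact hs _), key,
      Nat.add_mul_div_left _ _ (by positivity), Nat.div_eq_of_lt h0, zero_add]
    · conv_lhs => rw [← Nat.mod_add_div (s / 2 ^ 35) (2 ^ 35)]
      ring
    · have := hs 1
      rw [row_succ, row_zero] at this
      nlinarith

theorem pack_cons (b a : ℕ) (l : List ℕ) : pack b (a :: l) = b * pack b l + a := rfl

theorem pack_digit (b : ℕ) (l : List ℕ) (hl : ∀ a ∈ l, a < b) (i : ℕ) :
    pack b l / b ^ i % b = l.getD i 0 := by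
  induction l generalizing i with
  | nil => simp [pack]
  | cons a l ih =>
    have ha := hl a (by simp)
    have hb : 0 < b := by omega
    rw [pack_cons]
    cases i with
    | zero => simp [Nat.mod_eq_of_lt ha]
    | succ i =>
      rw [pow_succ', ← Nat.div_div_eq_div_mul, Nat.mul_add_div hb, Nat.div_eq_of_lt ha, add_zero,
        ih (fun x hx => hl x (by simp [hx]))]
      simp

theorem row_pack (l : List ℕ) (hl : ∀ a ∈ l, a < 2 ^ 35) (i : ℕ) :
    row (pack (2 ^ 35) l) i = l.getD i 0 := by
  rw [row, pow_mul, pack_digit _ _ hl]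

theorem pack_lt (b : ℕ) (l : List ℕ) (hl : ∀ a ∈ l, a < b) : pack b l < b ^ l.length := by
  induction l with
  | nil => simp [pack]
  | cons a l ih =>
    have ha := hl a (by simp)
    have := ih (fun x hx => hl x (by simp [hx]))
    rw [pack_cons, List.length_cons, pow_succ']
    nlinarith

theorem row_colMask (i : ℕ) : row colMask i = if 1 ≤ i ∧ i ≤ 35 then 1 else 0 := by
  rw [colMask, row_pack]
  · rcases i with _ | i
    · simp
    · simp only [List.getD_cons_succ]
      by_cases h : i < 35
      · rw [List.getD_eq_getElem _ _ (by simpa using h), List.getElem_replicate]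
        simp [h]
      · rw [List.getD_eq_default _ _ (by simpa using h)]
        simp; omega
  · intro a ha
    simp at ha
    rcases ha with rfl | rfl <;> norm_num

theorem lowBit_spec (n : ℕ) (hn : n ≠ 0) : ∃ k, n.testBit k = true ∧ lowBit n = 2 ^ k := by
  change ∃ k, n.testBit k = true ∧ n ^^^ (n &&& (n - 1)) = 2 ^ k
  induction n using Nat.strong_induction_on with
  | _ n ih =>
    rcases Nat.even_or_odd' n with ⟨m, rfl | rfl⟩
    · obtain ⟨k, hk, h⟩ := ih m (by omega) (by omega)
      refine ⟨k + 1, by simpa [Nat.testBit_succ] using hk, ?_⟩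
      rw [pow_succ', ← h]
      refine Nat.eq_of_testBit_eq fun i => ?_
      have h1 : (2 * m - 1) / 2 = m - 1 := by omega
      rcases i with _ | i
      · simp only [Nat.testBit_xor, Nat.testBit_and]
        simp
      · simp only [Nat.testBit_succ, Nat.xor_div_two, Nat.and_div_two, Nat.testBit_xor, Nat.testBit_and, h1]
        simp
    · refine ⟨0, by simp, ?_⟩
      refine Nat.eq_of_testBit_eq fun i => ?_
      have h1 : (2 * m + 1) / 2 = m := by omega
      rcases i with _ | i
      · simp only [Nat.testBit_xor, Nat.testBit_and]
        simp
      · simp only [Nat.testBit_succ, Nat.xor_div_two, Nat.and_div_two, Nat.testBit_xor, Nat.testBit_and, h1]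
        simp

/-- Soundness needs only that each row changes by a multiple of `v`; which rows the pivot selects is
a matter of efficiency. -/
theorem row_eliminate (M v i : ℕ) (hv : v < 2 ^ 35) :
    row (eliminate colMask M v) i = row M i ∨ row (eliminate colMask M v) i = row M i ^^^ v := by
  have key : ∀ x j, row (1 ||| (x &&& colMask)) j ≤ 1 := by
    intro x j
    have e : row (1 ||| (x &&& colMask)) j = row 1 j ||| (row x j &&& row colMask j) := by
      refine Nat.eq_of_testBit_eq fun r => ?_
      simp only [testBit_row, Nat.testBit_or, Nat.testBit_and]
      cases decide (r < 35) <;> simp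
    rw [e, row_colMask]
    split_ifs with h
    · have h1 : row 1 j = 0 := by
        rw [row, Nat.div_eq_of_lt]; · rfl
        exact Nat.one_lt_two_pow (by omega)
      rw [h1, Nat.zero_or]
      exact Nat.and_le_right
    · rw [Nat.and_zero, Nat.or_zero, row]
      exact (Nat.mod_le _ _).trans (Nat.div_le_self _ _)
  have h1 : row (eliminate colMask M v) i =
      row M i ^^^ row (1 ||| (M / lowBit v &&& colMask)) i * v := by
    rw [← row_mul _ _ _ (key _) hv, ← row_xor]; rfl
  rw [h1]
  rcases Nat.le_one_iff_eq_zero_or_eq_one.1 (key (M / lowBit v) i) with h | h <;> simp [h]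

theorem testBit_one_eq (r : ℕ) : Nat.testBit 1 r = decide (r = 0) := by
  rcases r with _ | r <;> simp [Nat.testBit_succ]

theorem row_clear (M v i j : ℕ) (hv : v < 2 ^ 35) (hi : 1 ≤ i) (hj : 1 ≤ j) (hij : i ≠ j) :
    row (M ^^^ v * (1 + 2 ^ (35 * j))) i = row M i := by
  have e : ∀ k, row (1 + 2 ^ (35 * j)) k = if k = 0 ∨ k = j then 1 else 0 := by
    intro k
    refine Nat.eq_of_testBit_eq fun r => ?_
    have : (1 + 2 ^ (35 * j)) = 2 ^ (35 * j) * 1 + 1 := by ring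
    rw [testBit_row, this, Nat.testBit_two_pow_mul_add _ (Nat.one_lt_two_pow (by omega))]
    by_cases hr : r < 35
    · by_cases h0 : k = 0
      · subst h0; simp [hr]; omega
      · by_cases h1 : k = j
        · subst h1; simp [hr]
        · rcases lt_or_gt_of_ne h1 with h | h
          · have : 35 * k + r < 35 * j := by omega
            simp [hr, this, h0, h1, testBit_one_eq]; try omega
          · have : ¬ 35 * k + r < 35 * j := by omega
            simp [hr, this, h0, h1, testBit_one_eq]; try omega
    · have : r ≠ 0 := by omega
      split_ifs <;> simp [hr, testBit_one_eq, this]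
  rw [row_xor, mul_comm v, row_mul _ _ _ _ hv, e]
  · have : ¬ (i = 0 ∨ i = j) := by omega
    simp [this]
  · intro k; rw [e]; split_ifs <;> omega

end RidgeSearch

namespace RidgeSearch

/-! ### Soundness of the search -/

/-- The sums mod 2 of members of the family `b i`, `i ∈ I`. -/
inductive InSpan (b : ℕ → ℕ) (I : Set ℕ) : ℕ → Prop
  | zero : InSpan b I 0
  | xor {i w : ℕ} : i ∈ I → InSpan b I w → InSpan b I (w ^^^ b i)

theorem InSpan.mono {b : ℕ → ℕ} {I J : Set ℕ} (h : I ⊆ J) {w : ℕ} (hw : InSpan b I w) :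
    InSpan b J w := by
  induction hw with
  | zero => exact .zero
  | xor hi _ ih => exact .xor (h hi) ih

theorem InSpan.add {b : ℕ → ℕ} {I : Set ℕ} {v w : ℕ} (hv : InSpan b I v) (hw : InSpan b I w) :
    InSpan b I (v ^^^ w) := by
  induction hw with
  | zero => simpa
  | xor hi _ ih => rw [← Nat.xor_assoc]; exact .xor hi ih

theorem InSpan.exists_finset {b : ℕ → ℕ} {I : Set ℕ} {w : ℕ} (hw : InSpan b I w) :
    ∃ G : Finset ℕ, (G : Set ℕ) ⊆ I ∧
      ∀ r, w.testBit r = decide (Odd (G.filter fun i => (b i).testBit r = true).card) := by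
  induction hw with
  | zero => exact ⟨∅, by simp, by simp⟩
  | @xor i w hi _ ih =>
    obtain ⟨G, hG, h⟩ := ih
    by_cases hiG : i ∈ G
    · refine ⟨G.erase i, fun x hx => hG (Finset.mem_of_mem_erase (Finset.mem_coe.1 hx)), fun r => ?_⟩
      rw [Nat.testBit_xor, h r, Finset.filter_erase]
      by_cases hb : (b i).testBit r = true
      · have hm : i ∈ G.filter fun i => (b i).testBit r = true := by simp [hiG, hb]
        rw [← Finset.card_erase_add_one hm, hb]
        by_cases ho : Odd ((G.filter fun i => (b i).testBit r = true).erase i).card <;> simp [Nat.odd_add_one, ho, Nat.not_odd_iff_even.1, -Nat.not_odd_iff_even]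
      · rw [Finset.erase_eq_of_notMem (by simp [hb])]
        simp [hb]
    · refine ⟨insert i G, ?_, fun r => ?_⟩
      · intro x hx
        rcases Finset.mem_insert.1 (by simpa using hx) with rfl | hx
        exacts [hi, hG hx]
      rw [Nat.testBit_xor, h r, Finset.filter_insert]
      by_cases hb : (b i).testBit r = true
      · rw [if_pos hb, Finset.card_insert_of_notMem (by simp [hiG]), hb]
        by_cases ho : Odd (G.filter fun i => (b i).testBit r = true).card <;> simp [Nat.odd_add_one, ho, Nat.not_odd_iff_even.1, -Nat.not_odd_iff_even]
      · rw [if_neg hb]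
        simp [hb]

/-- A family of rows of `D` in which no column is used exactly once, and in which no non-empty
subfamily uses every column an even number of times. -/
structure IsRigid (D : ℕ) (F : Set ℕ) : Prop where
  bounds : ∀ i ∈ F, 1 ≤ i ∧ i ≤ 35
  exists_ne : ∀ i ∈ F, ∀ r, (row D i).testBit r = true →
    ∃ j ∈ F, j ≠ i ∧ (row D j).testBit r = true
  eq_empty : ∀ G : Finset ℕ, (G : Set ℕ) ⊆ F →
    (∀ r, ¬ Odd (G.filter fun i => (row D i).testBit r = true).card) → G = ∅

/-- A dependence of row `i` on the rows of `I`, together with `i`, would be a non-empty subfamily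
using every column evenly. -/
theorem IsRigid.not_inSpan {D : ℕ} {F : Set ℕ} (hF : IsRigid D F) {I : Set ℕ} (hI : I ⊆ F) {i : ℕ}
    (hi : i ∈ F) (hiI : i ∉ I) : ¬ InSpan (row D) I (row D i) := by
  intro h
  obtain ⟨G, hG, hr⟩ := h.exists_finset
  have hiG : i ∉ G := fun h => hiI (hG h)
  have := hF.eq_empty (insert i G) (by
    intro x hx
    rcases Finset.mem_insert.1 (by simpa using hx) with rfl | hx
    exacts [hi, hI (hG hx)]) (by
    intro r
    have hr := hr r
    rw [Finset.filter_insert]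
    split_ifs with hb
    · rw [Finset.card_insert_of_notMem (by simp [hiG]), Nat.odd_add_one, not_not]
      simpa [hb] using hr
    · simpa [hb] using hr)
  simp at this

/-- The state of the search after the members `I` of `F` have been found: `M` holds the rows of the
other members modulo the rows of `I`, and `one` and `two` hold the columns that are used at least
once and at least twice in `I`. -/
structure State (D : ℕ) (F I : Set ℕ) (M one two : ℕ) : Prop where
  subset : I ⊆ F
  reduced : ∀ i ∈ F, i ∉ I → InSpan (row D) I (row M i ^^^ row D i)
  one_iff : ∀ r, one.testBit r = true ↔ ∃ i ∈ I, (row D i).testBit r = true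
  two_iff : ∀ r, two.testBit r = true ↔
    ∃ i ∈ I, ∃ j ∈ I, i ≠ j ∧ (row D i).testBit r = true ∧ (row D j).testBit r = true

theorem State.row_ne_zero {D : ℕ} {F I : Set ℕ} {M one two : ℕ} (hF : IsRigid D F)
    (h : State D F I M one two) {i : ℕ} (hi : i ∈ F) (hiI : i ∉ I) : row M i ≠ 0 := by
  intro h0
  have := h.reduced i hi hiI
  rw [h0, Nat.zero_xor] at this
  exact hF.not_inSpan h.subset hi hiI this

theorem State.insert {D : ℕ} {F I : Set ℕ} {M one two : ℕ}
    (h : State D F I M one two) {i : ℕ} (hi : i ∈ F) (hiI : i ∉ I) :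
    State D F (insert i I) (eliminate colMask M (row M i)) (one ||| row D i)
      (two ||| (one &&& row D i)) where
  subset := Set.insert_subset hi h.subset
  reduced j hj hjI := by
    rw [Set.mem_insert_iff, not_or] at hjI
    have hsub : I ⊆ Insert.insert i I := Set.subset_insert _ _
    have hj' := (h.reduced j hj hjI.2).mono hsub
    rcases row_eliminate M (row M i) j (row_lt _ _) with e | e
    · rwa [e]
    · have hi' := (h.reduced i hi hiI).mono hsub
      have hi'' : InSpan (row D) (Insert.insert i I) (row M i) := by
        have := InSpan.xor (Set.mem_insert i I) hi'
        rwa [Nat.xor_assoc, Nat.xor_self, Nat.xor_zero] at this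
      rw [e, Nat.xor_assoc, Nat.xor_comm (row M i), ← Nat.xor_assoc]
      exact hj'.add hi''
  one_iff r := by
    rw [Nat.testBit_or, Bool.or_eq_true, h.one_iff]
    simp [or_comm]
  two_iff r := by
    rw [Nat.testBit_or, Nat.testBit_and, Bool.or_eq_true, Bool.and_eq_true, h.two_iff, h.one_iff]
    constructor
    · rintro (⟨a, ha, b, hb, h⟩ | ⟨⟨a, ha, h⟩, h'⟩)
      · exact ⟨a, .inr ha, b, .inr hb, h⟩
      · exact ⟨a, .inr ha, i, .inl rfl, fun e => hiI (e ▸ ha), h, h'⟩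
    · rintro ⟨a, ha | ha, b, hb | hb, hab, h1, h2⟩
      · exact absurd (ha.trans hb.symm) hab
      · exact .inr ⟨⟨b, hb, h2⟩, ha ▸ h1⟩
      · exact .inr ⟨⟨a, ha, h1⟩, hb ▸ h2⟩
      · exact .inl ⟨a, ha, b, hb, hab, h1, h2⟩

/-- The invariant constrains only the rows of members of `F` not yet found, so the row of a refuted
candidate may be destroyed. -/
theorem State.clear {D : ℕ} {F I : Set ℕ} {M one two : ℕ} (hF : IsRigid D F)
    (h : State D F I M one two) {j v : ℕ} (hj : 1 ≤ j) (hjF : j ∈ F → j ∈ I) (hv : v < 2 ^ 35) :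
    State D F I (M ^^^ v * (1 + 2 ^ (35 * j))) one two where
  subset := h.subset
  reduced i hi hiI := by
    rw [row_clear M v i j hv (hF.bounds i hi).1 hj (fun e => hiI (e ▸ hjF (e ▸ hi)))]
    exact h.reduced i hi hiI
  one_iff := h.one_iff
  two_iff := h.two_iff

theorem beq_false_of_ne {m n : ℕ} (h : m ≠ n) : Nat.beq m n = false :=
  Bool.eq_false_iff.2 fun e => h (Nat.eq_of_beq_eq_true e)

theorem loop_succ (D u w : ℕ) (next : ℕ → ℕ → ℕ → Bool) (one two n M c : ℕ) :
    loop D u w next one two (n + 1) M c =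
      bif Nat.beq c 0 then true else
      bif Nat.beq (Nat.land (Nat.div M (lowBit c)) w) 0 then
        loop D u w next one two n M (c ^^^ lowBit c) else
      bif next (eliminate u M (Nat.land (Nat.div M (lowBit c)) w))
          (one ||| Nat.land (Nat.div D (lowBit c)) w)
          (two ||| (one &&& Nat.land (Nat.div D (lowBit c)) w))
      then loop D u w next one two n
        (M ^^^ Nat.land (Nat.div M (lowBit c)) w * (1 + lowBit c)) (c ^^^ lowBit c)
      else false := by
  have : loop D u w next one two (n + 1) M c =
      bif Nat.beq c 0 then true else
      (fun k => (fun row => (fun c' =>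
        bif Nat.beq row 0 then loop D u w next one two n M c' else
        bif (fun b => force (eliminate u M row) fun M' =>
            force (Nat.lor two (Nat.land one b)) fun two' =>
            force (Nat.lor one b) fun one' => next M' one' two') (Nat.land (Nat.div D k) w)
        then force (Nat.xor M (Nat.mul row (Nat.add 1 k))) fun M' => loop D u w next one two n M' c'
        else false) (Nat.xor c k)) (Nat.land (Nat.div M k) w)) (lowBit c) := rfl
  rw [this]
  simp only [force_eq]
  rfl

theorem search_succ (D u w n M one two : ℕ) :
    search D u w (n + 1) M one two =
      bif Nat.beq (one ^^^ two) 0 then false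
      else loop D u w (search D u w n) one two 6 M
        (Nat.land (Nat.div D (lowBit (one ^^^ two))) u) := by
  have : search D u w (n + 1) M one two =
      force (Nat.xor one two) fun m =>
        bif Nat.beq m 0 then false
        else loop D u w (search D u w n) one two 6 M (Nat.land (Nat.div D (lowBit m)) u) := rfl
  rw [this, force_eq]
  rfl

/-- An unfound member `i` of `F` among the candidates survives every skip and every clearing, so the
loop cannot finish successfully before reaching a member of `F`, where `next` refuses. -/
theorem loop_sound {D : ℕ} {F I : Set ℕ} (hF : IsRigid D F) {next : ℕ → ℕ → ℕ → Bool}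
    (hnext : ∀ i ∈ F, i ∉ I → ∀ M one two, State D F (insert i I) M one two →
      next M one two = false)
    {one two n : ℕ} {M c : ℕ} (h : State D F I M one two)
    (hc : ∀ t, c.testBit t = true → ∃ j, 1 ≤ j ∧ t = 35 * j)
    {i : ℕ} (hi : i ∈ F) (hiI : i ∉ I) (hic : c.testBit (35 * i) = true) :
    loop D colMask rowMask next one two n M c = false := by
  have c_ne : ∀ {c i : ℕ}, c.testBit i = true → c ≠ 0 := by
    rintro c i hc rfl
    simp at hc
  induction n generalizing M c with
  | zero =>
    change Nat.beq c 0 = false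
    exact beq_false_of_ne (c_ne hic)
  | succ n ih =>
    obtain ⟨t, ht, hlow⟩ := lowBit_spec c (c_ne hic)
    obtain ⟨j, hj, rfl⟩ := hc t ht
    have hc' : ∀ t, (c ^^^ 2 ^ (35 * j)).testBit t = true → ∃ j, 1 ≤ j ∧ t = 35 * j := by
      intro t ht'
      rw [Nat.testBit_xor, Nat.testBit_two_pow] at ht'
      by_cases e : 35 * j = t
      · exact ⟨j, hj, e.symm⟩
      · exact hc t (by simpa [e] using ht')
    have hic' : i ≠ j → (c ^^^ 2 ^ (35 * j)).testBit (35 * i) = true := by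
      intro hij
      rw [Nat.testBit_xor, hic, Nat.testBit_two_pow_of_ne (by omega)]
      rfl
    rw [loop_succ, beq_false_of_ne (c_ne hic), hlow, land_rowMask, land_rowMask]
    simp only [cond_false]
    by_cases h0 : row M j = 0
    · rw [h0]
      rw [show Nat.beq 0 0 = true from rfl, cond_true]
      refine ih h hc' (hic' ?_)
      rintro rfl
      exact h.row_ne_zero hF hi hiI h0
    · rw [beq_false_of_ne h0]
      simp only [cond_false]
      by_cases hjF : j ∈ F ∧ j ∉ I
      · rw [hnext j hjF.1 hjF.2 _ _ _ (h.insert hjF.1 hjF.2)]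
        rfl
      · have hjF' : j ∈ F → j ∈ I := fun h => not_not.1 fun h' => hjF ⟨h, h'⟩
        -- Candidate `j` is not an unfound member, so nothing is known about `next`; the loop fails
        -- whichever way it answers.
        rw [ih (h.clear hF hj hjF' (row_lt _ _)) hc' (hic' fun e => hiI (e ▸ hjF' (e ▸ hi)))]
        exact Bool.cond_self _ _

theorem search_sound {D : ℕ} {F : Set ℕ} (hF : IsRigid D F) {n : ℕ} {I : Set ℕ} {M one two : ℕ}
    (h : State D F I M one two) : search D colMask rowMask n M one two = false := by
  induction n generalizing I M one two with
  | zero => rfl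
  | succ n ih =>
    rw [search_succ]
    by_cases h0 : one ^^^ two = 0
    · rw [h0]; rfl
    rw [beq_false_of_ne h0, cond_false]
    obtain ⟨r, hr, hlow⟩ := lowBit_spec _ h0
    rw [hlow]
    have htwo : two.testBit r = true → one.testBit r = true := fun h2 => by
      obtain ⟨i, hi, -, -, -, hir, -⟩ := (h.two_iff r).1 h2
      exact (h.one_iff r).2 ⟨i, hi, hir⟩
    rw [Nat.testBit_xor] at hr
    have h1 : one.testBit r = true := by
      by_contra h1
      refine h1 (htwo ?_)
      rw [Bool.not_eq_true] at h1
      simpa [h1] using hr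
    have h2 : ¬ two.testBit r = true := by
      intro h2
      simp [h1, h2] at hr
    obtain ⟨i, hi, hir⟩ := (h.one_iff r).1 h1
    -- Ridge `r` is used once in `I`, so rigidity supplies a further member of `F` containing it,
    -- necessarily outside `I`.
    obtain ⟨j, hj, hji, hjr⟩ := hF.exists_ne i (h.subset hi) r hir
    have hjI : j ∉ I := fun hjI => h2 ((h.two_iff r).2 ⟨i, hi, j, hjI, hji.symm, hir, hjr⟩)
    have hcol : ∀ k s, (colMask).testBit (35 * k + s) = true → s < 35 → 1 ≤ k ∧ k ≤ 35 ∧ s = 0 := by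
      intro k s hks hs
      have : (row colMask k).testBit s = true := by rw [testBit_row]; simp [hs, hks]
      rw [row_colMask] at this
      split_ifs at this with hk
      · rw [testBit_one_eq] at this
        exact ⟨hk.1, hk.2, by simpa using this⟩
      · simp at this
    refine loop_sound hF (fun i _ _ M one two h => ih h) h ?_ hj hjI ?_
    · intro t ht
      replace ht : ((D / 2 ^ r) &&& colMask).testBit t = true := ht
      rw [Nat.testBit_and, Bool.and_eq_true] at ht
      have e := Nat.div_add_mod t 35
      have := hcol (t / 35) (t % 35) (by rw [e]; exact ht.2) (Nat.mod_lt _ (by norm_num))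
      exact ⟨t / 35, this.1, by omega⟩
    · change ((D / 2 ^ r) &&& colMask).testBit (35 * j) = true
      have hb := hF.bounds j hj
      rw [testBit_row, Bool.and_eq_true] at hjr
      have : (row colMask j).testBit 0 = true := by
        rw [row_colMask, if_pos hb]; rfl
      rw [testBit_row, Bool.and_eq_true] at this
      rw [Nat.testBit_and, Bool.and_eq_true, Nat.testBit_div_two_pow]
      exact ⟨hjr.2, this.2⟩

theorem searchFrom_sound {D : ℕ} {F : Set ℕ} (hF : IsRigid D F) (l : List ℕ) (hl : l.Nodup)
    (hlF : ∀ i ∈ l, i ∈ F) {I : Set ℕ} (hlI : ∀ i ∈ l, i ∉ I) {M one two : ℕ}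
    (h : State D F I M one two) : searchFrom D colMask rowMask l M one two = false := by
  induction l generalizing I M one two with
  | nil => exact search_sound hF h
  | cons f l ih =>
    rw [List.nodup_cons] at hl
    have hf : f ∈ F := hlF f (by simp)
    have hfI : f ∉ I := hlI f (by simp)
    have e : searchFrom D colMask rowMask (f :: l) M one two =
        searchFrom D colMask rowMask l (eliminate colMask M (row M f)) (one ||| row D f)
          (two ||| (one &&& row D f)) := by
      simp only [searchFrom, force_eq]
      rw [show Nat.pow 2 (Nat.mul 35 f) = 2 ^ (35 * f) from rfl, land_rowMask, land_rowMask]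
      rfl
    rw [e]
    refine ih hl.2 (fun i hi => hlF i (by simp [hi])) (fun i hi => ?_) (h.insert hf hfI)
    rintro (rfl | hiI)
    exacts [hl.1 hi, hlI i (by simp [hi]) hiI]

theorem not_isRigid {d : ℕ} {l : List ℕ} (h : noFamilyContaining d l = true) {F : Set ℕ}
    (hl : (l.map ((0 :: masks (d + 1)).idxOf)).Nodup)
    (hlF : ∀ i ∈ l, (0 :: masks (d + 1)).idxOf i ∈ F) : ¬ IsRigid (boundaryMatrix d) F := by
  intro hF
  rw [noFamilyContaining] at h
  simp only [force_eq] at h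
  rw [searchFrom_sound hF _ hl (by simpa using hlF) (I := ∅) (by simp)] at h
  · simp at h
  · refine ⟨Set.empty_subset _, fun i _ _ => ?_, by simp, by simp⟩
    rw [Nat.xor_self]
    exact .zero

/-- The masks here and in the next three results code the facets `{0, …, d - 1, d + j}` with `j <
3`. The kernel runs the whole search. -/
theorem noFamilyContaining_one : noFamilyContaining 1 [3, 5, 9] = true := by decide +kernel

theorem noFamilyContaining_two : noFamilyContaining 2 [7, 11, 19] = true := by decide +kernel

theorem noFamilyContaining_three : noFamilyContaining 3 [15, 23, 39] = true := by decide +kernel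

theorem noFamilyContaining_four : noFamilyContaining 4 [31, 47, 79] = true := by decide +kernel

end RidgeSearch

namespace RidgeSearch

/-! ### From bit masks to families of finite sets -/

/-- The bit mask of a set of vertices. -/
def code (s : Finset (Fin 7)) : ℕ := ∑ v ∈ s, 2 ^ (v : ℕ)

def decode (m : ℕ) : Finset (Fin 7) := Finset.univ.filter fun v => m.testBit v = true

theorem testBit_code (s : Finset (Fin 7)) (v : Fin 7) : (code s).testBit v = decide (v ∈ s) := by
  revert s v
  decide +kernel

theorem code_lt (s : Finset (Fin 7)) : code s < 2 ^ 7 := by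
  revert s
  decide +kernel

theorem popCount_code (s : Finset (Fin 7)) : popCount (code s) = s.card := by
  revert s
  decide +kernel

theorem code_decode_fin (m : Fin 128) : code (decode m) = m := by
  revert m
  decide +kernel

theorem decode_code (s : Finset (Fin 7)) : decode (code s) = s := by
  ext v
  simp [decode, testBit_code]

theorem code_injective : Function.Injective code :=
  Function.LeftInverse.injective decode_code

theorem code_mem_masks (s : Finset (Fin 7)) : code s ∈ masks s.card := by
  rw [masks, List.mem_filter, List.mem_range]
  exact ⟨code_lt s, by rw [popCount_code]; exact Nat.beq_refl _⟩

theorem mem_masks {k m : ℕ} (h : m ∈ masks k) : code (decode m) = m ∧ (decode m).card = k := by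
  rw [masks, List.mem_filter, List.mem_range] at h
  have e := code_decode_fin ⟨m, h.1⟩
  refine ⟨e, ?_⟩
  rw [← popCount_code, e]
  exact Nat.eq_of_beq_eq_true h.2

theorem land_code (r s : Finset (Fin 7)) : code r &&& code s = code r ↔ r ⊆ s := by
  constructor
  · intro h v hv
    have := testBit_code r v
    rw [← h, Nat.testBit_and, testBit_code, testBit_code] at this
    simpa [hv] using this
  · intro h
    refine Nat.eq_of_testBit_eq fun i => ?_
    rw [Nat.testBit_and]
    by_cases hi : i < 7
    · have h1 := testBit_code r ⟨i, hi⟩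
      have h2 := testBit_code s ⟨i, hi⟩
      simp only at h1 h2
      rw [h1, h2]
      by_cases hr : (⟨i, hi⟩ : Fin 7) ∈ r
      · simp [hr, h hr]
      · simp [hr]
    · rw [Nat.testBit_lt_two_pow ((code_lt r).trans_le (Nat.pow_le_pow_right (by norm_num)
        (not_lt.1 hi)))]
      rfl

theorem length_masks (k : ℕ) (hk : k ≤ 7) : (masks k).length ≤ 35 := by
  revert k
  decide +kernel

theorem pos_of_mem_masks {k m : ℕ} (h : m ∈ masks (k + 1)) : m ≠ 0 := by
  rintro rfl
  have := mem_masks h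
  simp [decode] at this

theorem facetBoundary_lt {d : ℕ} (hd : d ≤ 7) (m : ℕ) : facetBoundary d m < 2 ^ 35 := by
  refine (pack_lt 2 _ ?_).trans_le (Nat.pow_le_pow_right (by norm_num) ?_)
  · intro a ha
    obtain ⟨r, -, rfl⟩ := List.mem_map.1 ha
    cases Nat.beq (Nat.land r m) r <;> simp
  · rw [List.length_map]
    exact length_masks d hd

theorem testBit_facetBoundary {d : ℕ} (s : Finset (Fin 7)) (r : ℕ) :
    (facetBoundary d (code s)).testBit r = true ↔
      ∃ t : Finset (Fin 7), t.card = d ∧ (masks d)[r]? = some (code t) ∧ t ⊆ s := by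
  rw [Nat.testBit_eq_decide_div_mod_eq, facetBoundary, pack_digit]
  · rw [List.getD_eq_getElem?_getD, List.getElem?_map, decide_eq_true_iff]
    constructor
    · intro h
      cases hr : (masks d)[r]? with
      | none => simp [hr] at h
      | some m =>
        have hm := mem_masks (List.mem_of_getElem? hr)
        refine ⟨decode m, hm.2, by rw [hm.1], (land_code _ _).1 ?_⟩
        rw [hm.1]
        simp only [hr, Option.map_some, Option.getD_some] at h
        cases hb : Nat.beq (m &&& code s) m with
        | false => simp [hb] at h
        | true => exact Nat.eq_of_beq_eq_true hb
    · rintro ⟨t, -, hr, hts⟩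
      have : code t &&& code s = code t := (land_code _ _).2 hts
      simp [hr, this, Nat.beq_refl]
  · intro a ha
    obtain ⟨r, -, rfl⟩ := List.mem_map.1 ha
    cases Nat.beq (Nat.land r (code s)) r <;> simp

def facetIndex (d : ℕ) (s : Finset (Fin 7)) : ℕ := (0 :: masks (d + 1)).idxOf (code s)

theorem facetIndex_eq {d : ℕ} {s : Finset (Fin 7)} (hs : s.card = d + 1) :
    facetIndex d s = (masks (d + 1)).idxOf (code s) + 1 := by
  have h := pos_of_mem_masks (k := d) (m := code s) (hs ▸ code_mem_masks s)
  rw [facetIndex, List.idxOf_cons_ne _ h.symm]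

theorem row_facetIndex {d : ℕ} (hd : d ≤ 6) {s : Finset (Fin 7)} (hs : s.card = d + 1) :
    row (boundaryMatrix d) (facetIndex d s) = facetBoundary d (code s) := by
  rw [boundaryMatrix, row_pack, facetIndex_eq hs, List.getD_cons_succ, List.getD_eq_getElem?_getD,
    List.getElem?_map, List.getElem?_idxOf (hs ▸ code_mem_masks s)]
  · rfl
  · intro a ha
    rcases List.mem_cons.1 ha with rfl | ha
    · norm_num
    · obtain ⟨m, -, rfl⟩ := List.mem_map.1 ha
      exact facetBoundary_lt (by omega) m

theorem facetIndex_inj {d : ℕ} {s t : Finset (Fin 7)} (hs : s.card = d + 1) (ht : t.card = d + 1)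
    (h : facetIndex d s = facetIndex d t) : s = t := by
  rw [facetIndex_eq hs, facetIndex_eq ht, add_left_inj,
    List.idxOf_inj (hs ▸ code_mem_masks s)] at h
  exact code_injective h

/-- A family of `d`-dimensional simplices in which no ridge is in exactly one simplex, and in which
no non-empty subfamily is a cycle mod 2. -/
structure IsRigidFamily {V : Type*} [DecidableEq V] (d : ℕ) (F : Finset (Finset V)) : Prop where
  card_eq : ∀ s ∈ F, s.card = d + 1
  exists_ne : ∀ s ∈ F, ∀ r ⊆ s, r.card = d → ∃ t ∈ F, t ≠ s ∧ r ⊆ t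
  eq_empty : ∀ G ⊆ F, (∀ r : Finset V, r.card = d → ¬ Odd (G.filter fun s => r ⊆ s).card) → G = ∅

theorem IsRigidFamily.isRigid {d : ℕ} (hd : d ≤ 6) {F : Finset (Finset (Fin 7))}
    (h : IsRigidFamily d F) : IsRigid (boundaryMatrix d) (F.image (facetIndex d)) where
  bounds i hi := by
    obtain ⟨s, hs, rfl⟩ := Finset.mem_image.1 (Finset.mem_coe.1 hi)
    have hs' := h.card_eq s hs
    have := List.idxOf_lt_length_of_mem (hs' ▸ code_mem_masks s)
    have := length_masks (d + 1) (by omega)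
    rw [facetIndex_eq hs']
    omega
  exists_ne i hi r hr := by
    obtain ⟨s, hs, rfl⟩ := Finset.mem_image.1 (Finset.mem_coe.1 hi)
    have hs' := h.card_eq s hs
    rw [row_facetIndex hd hs', testBit_facetBoundary] at hr
    obtain ⟨t, ht, htr, hts⟩ := hr
    obtain ⟨s', hs'F, hne, hts'⟩ := h.exists_ne s hs t hts ht
    have hs'' := h.card_eq s' hs'F
    refine ⟨facetIndex d s', by simpa using ⟨s', hs'F, rfl⟩,
      fun e => hne (facetIndex_inj hs'' hs' e), ?_⟩
    rw [row_facetIndex hd hs'', testBit_facetBoundary]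
    exact ⟨t, ht, htr, hts'⟩
  eq_empty G hG hodd := by
    have hGF : ∀ i ∈ G, ∃ s ∈ F, facetIndex d s = i := fun i hi => by
      simpa using hG hi
    have := h.eq_empty (F.filter fun s => facetIndex d s ∈ G) (Finset.filter_subset _ _) ?_
    · refine Finset.eq_empty_of_forall_notMem fun i hi => ?_
      obtain ⟨s, hs, rfl⟩ := hGF i hi
      exact Finset.notMem_empty s (this ▸ Finset.mem_filter.2 ⟨hs, hi⟩)
    · intro t ht
      convert hodd ((masks d).idxOf (code t)) using 2
      have hr : (masks d)[(masks d).idxOf (code t)]? = some (code t) :=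
        List.getElem?_idxOf (ht ▸ code_mem_masks t)
      refine Finset.card_bij (fun s _ => facetIndex d s) ?_ ?_ ?_
      · intro s hs
        rw [Finset.mem_filter, Finset.mem_filter] at hs
        rw [Finset.mem_filter, row_facetIndex hd (h.card_eq s hs.1.1), testBit_facetBoundary]
        exact ⟨hs.1.2, t, ht, hr, hs.2⟩
      · intro s hs s' hs' e
        rw [Finset.mem_filter, Finset.mem_filter] at hs hs'
        exact facetIndex_inj (h.card_eq s hs.1.1) (h.card_eq s' hs'.1.1) e
      · intro i hi
        rw [Finset.mem_filter] at hi
        obtain ⟨s, hs, rfl⟩ := hGF i hi.1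
        rw [row_facetIndex hd (h.card_eq s hs), testBit_facetBoundary, hr] at hi
        obtain ⟨t', -, ht', hts⟩ := hi.2
        rw [Option.some_inj] at ht'
        exact ⟨s, by simp [hs, hi.1, code_injective ht', hts], rfl⟩

theorem not_isRigidFamily_of_search {d : ℕ} (hd : d ≤ 6) {F : Finset (Finset (Fin 7))}
    {l : List (Finset (Fin 7))} (hl : noFamilyContaining d (l.map code) = true) (hn : l.Nodup)
    (hlF : ∀ s ∈ l, s ∈ F) : ¬ IsRigidFamily d F := by
  intro h
  refine not_isRigid hl ?_ ?_ (h.isRigid hd)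
  · rw [List.map_map]
    refine List.Nodup.map_on (fun s hs t ht e => ?_) hn
    exact facetIndex_inj (h.card_eq s (hlF s hs)) (h.card_eq t (hlF t ht)) e
  · intro i hi
    obtain ⟨s, hs, rfl⟩ := List.mem_map.1 hi
    exact Finset.mem_coe.2 (Finset.mem_image_of_mem _ (hlF s hs))

/-- The set `{0, …, d - 1, d + j}`. -/
def initialFacet (d j : ℕ) : Finset (Fin 7) :=
  Finset.univ.filter fun v => (v : ℕ) < d ∨ (v : ℕ) = d + j

theorem not_isRigidFamily_of_initialFacet {d : ℕ} (hd : 1 ≤ d) (hd' : d ≤ 4)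
    {F : Finset (Finset (Fin 7))} (hF : ∀ j < 3, initialFacet d j ∈ F) : ¬ IsRigidFamily d F := by
  refine not_isRigidFamily_of_search (l := [initialFacet d 0, initialFacet d 1, initialFacet d 2])
    (by omega) ?_ ?_ ?_
  · interval_cases d
    · exact noFamilyContaining_one
    · exact noFamilyContaining_two
    · exact noFamilyContaining_three
    · exact noFamilyContaining_four
  · interval_cases d <;> decide
  · simp [hF]

end RidgeSearch

/-! ### Relabelling an arbitrary vertex set of size at most seven. -/

namespace RidgeSearch

variable {V W : Type*} [DecidableEq W]

theorem image_subset_image_iff {φ : V → W} {S a b : Finset V} (hφ : Set.InjOn φ S) (ha : a ⊆ S)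
    (hb : b ⊆ S) : a.image φ ⊆ b.image φ ↔ a ⊆ b := by
  refine ⟨fun h v hv => ?_, fun h => Finset.image_subset_image h⟩
  obtain ⟨w, hw, e⟩ := Finset.mem_image.1 (h (Finset.mem_image_of_mem φ hv))
  rwa [← hφ (hb hw) (ha hv) e]

theorem image_inj {φ : V → W} {S a b : Finset V} (hφ : Set.InjOn φ S) (ha : a ⊆ S)
    (hb : b ⊆ S) (h : a.image φ = b.image φ) : a = b :=
  ((image_subset_image_iff hφ ha hb).1 h.subset).antisymm
    ((image_subset_image_iff hφ hb ha).1 h.superset)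

variable [DecidableEq V]

/-- Rigidity is purely combinatorial, so it is invariant under a relabelling that is injective on
the vertices in use. -/
theorem IsRigidFamily.image {d : ℕ} {F : Finset (Finset V)} (h : IsRigidFamily d F) {S : Finset V}
    (hS : ∀ s ∈ F, s ⊆ S) {φ : V → W} (hφ : Set.InjOn φ S) :
    IsRigidFamily d (F.image (Finset.image φ)) where
  card_eq s' hs' := by
    obtain ⟨s, hs, rfl⟩ := Finset.mem_image.1 hs'
    rw [Finset.card_image_of_injOn (hφ.mono (hS s hs)), h.card_eq s hs]
  exists_ne s' hs' r' hr' hcard := by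
    obtain ⟨s, hs, rfl⟩ := Finset.mem_image.1 hs'
    have e : (s.filter fun v => φ v ∈ r').image φ = r' := by
      ext w
      simp only [Finset.mem_image, Finset.mem_filter]
      constructor
      · rintro ⟨v, hv, rfl⟩
        exact hv.2
      · intro hw
        obtain ⟨v, hv, rfl⟩ := Finset.mem_image.1 (hr' hw)
        exact ⟨v, ⟨hv, hw⟩, rfl⟩
    have hsub := Finset.filter_subset (fun v => φ v ∈ r') s
    obtain ⟨t, ht, hts, hrt⟩ := h.exists_ne s hs (s.filter fun v => φ v ∈ r') hsub (by
      rw [← hcard, ← e, Finset.card_image_of_injOn (hφ.mono (Finset.coe_subset.2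
        (hsub.trans (hS s hs)))), e])
    refine ⟨t.image φ, Finset.mem_image_of_mem _ ht,
      fun e => hts (image_inj hφ (hS t ht) (hS s hs) e), ?_⟩
    rw [← e]
    exact Finset.image_subset_image hrt
  eq_empty G' hG' hodd := by
    have := h.eq_empty (F.filter fun s => s.image φ ∈ G') (Finset.filter_subset _ _) ?_
    · refine Finset.eq_empty_of_forall_notMem fun s' hs' => ?_
      obtain ⟨s, hs, rfl⟩ := Finset.mem_image.1 (hG' hs')
      exact Finset.notMem_empty s (this ▸ Finset.mem_filter.2 ⟨hs, hs'⟩)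
    · intro r hr
      by_cases hrS : r ⊆ S
      · convert hodd (r.image φ) (by
          rw [Finset.card_image_of_injOn (hφ.mono (Finset.coe_subset.2 hrS)), hr]) using 2
        refine Finset.card_bij (fun s _ => s.image φ) ?_ ?_ ?_
        · intro s hs
          rw [Finset.mem_filter, Finset.mem_filter] at hs
          exact Finset.mem_filter.2 ⟨hs.1.2, Finset.image_subset_image hs.2⟩
        · intro s hs t ht e
          rw [Finset.mem_filter, Finset.mem_filter] at hs ht
          exact image_inj hφ (hS s hs.1.1) (hS t ht.1.1) e
        · intro s' hs'
          rw [Finset.mem_filter] at hs'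
          obtain ⟨s, hs, rfl⟩ := Finset.mem_image.1 (hG' hs'.1)
          exact ⟨s, by
            rw [Finset.mem_filter, Finset.mem_filter]
            exact ⟨⟨hs, hs'.1⟩, (image_subset_image_iff hφ hrS (hS s hs)).1 hs'.2⟩, rfl⟩
      · rw [Finset.filter_eq_empty_iff.2]
        · simp
        · intro s hs hrs
          exact hrS (hrs.trans (hS s (Finset.mem_filter.1 hs).1))

theorem card_initialFacet {d j : ℕ} (h : d + j < 7) : (initialFacet d j).card = d + 1 := by
  have hd : d < 7 := by omega
  have hj : j < 7 := by omega
  interval_cases d <;> interval_cases j <;> first | omega | decide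

/-- There is no non-empty rigid family of simplices of positive dimension on at most seven
vertices. -/
theorem not_isRigidFamily {V : Type*} [DecidableEq V] {d : ℕ} (hd : 1 ≤ d) {F : Finset (Finset V)} (hF : F.Nonempty)
    {S : Finset V} (hS : ∀ s ∈ F, s ⊆ S) (hcard : S.card ≤ 7) : ¬ IsRigidFamily d F := by
  intro h
  obtain ⟨r, hr, hodd⟩ : ∃ r : Finset V, r.card = d ∧ Odd (F.filter fun s => r ⊆ s).card := by
    by_contra! hcon
    exact hF.ne_empty (h.eq_empty F subset_rfl fun r hr => by simpa using hcon r hr)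
  -- The number of members over `r` is odd, and rigidity excludes one, so there are at least three.
  have h1 : (F.filter fun s => r ⊆ s).card ≠ 1 := by
    intro h1
    obtain ⟨s, hs⟩ := Finset.card_eq_one.1 h1
    have hsF := Finset.mem_filter.1 (hs ▸ Finset.mem_singleton_self s)
    obtain ⟨t, ht, hts, hrt⟩ := h.exists_ne s hsF.1 r hsF.2 hr
    exact hts (Finset.mem_singleton.1 (hs ▸ Finset.mem_filter.2 ⟨ht, hrt⟩))
  obtain ⟨a, ha, b, hb, c, hc, hab, hac, hbc⟩ := Finset.two_lt_card.1
    (show 2 < (F.filter fun s => r ⊆ s).card by obtain ⟨k, hk⟩ := hodd; omega)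
  have apex : ∀ s ∈ F.filter fun s => r ⊆ s, ∃ x ∉ r, insert x r = s := fun s hs => by
    rw [Finset.mem_filter] at hs
    exact ((Finset.covBy_iff_exists_insert).1 (Finset.covBy_iff_card_sdiff_eq_one.2 ⟨hs.2, by
      rw [Finset.card_sdiff_of_subset hs.2, h.card_eq s hs.1, hr]; omega⟩))
  obtain ⟨x, hx, rfl⟩ := apex a ha
  obtain ⟨y, hy, rfl⟩ := apex b hb
  obtain ⟨z, hz, rfl⟩ := apex c hc
  replace hab : x ≠ y := fun e => hab (by rw [e])
  replace hac : x ≠ z := fun e => hac (by rw [e])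
  replace hbc : y ≠ z := fun e => hbc (by rw [e])
  rw [Finset.mem_filter] at ha hb hc
  set T : Finset V := insert x (insert y (insert z r)) with hT
  have hTS : T ⊆ S := by
    have h1 := hS _ ha.1
    have h2 := hS _ hb.1
    have h3 := hS _ hc.1
    intro v hv
    simp only [hT, Finset.mem_insert] at hv
    rcases hv with rfl | rfl | rfl | hv
    exacts [h1 (by simp), h2 (by simp), h3 (by simp), h1 (by simp [hv])]
  have hTcard : T.card = d + 3 := by
    rw [hT, Finset.card_insert_of_notMem (by simp [hab, hac, hx]),
      Finset.card_insert_of_notMem (by simp [hbc, hy]), Finset.card_insert_of_notMem hz, hr]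
  have hd4 : d + 3 ≤ 7 := hTcard ▸ (Finset.card_le_card hTS).trans hcard
  -- The position in this list is the new label: the ridge gets `0, …, d - 1` and the three apexes
  -- get `d`, `d + 1`, `d + 2`.
  set L : List V := r.toList ++ ([x, y, z] ++ (S \ T).toList) with hL
  have hmem : ∀ v, v ∈ L ↔ v ∈ S := by
    intro v
    have : v ∈ T → v ∈ S := fun h => hTS h
    simp only [hL, hT, List.mem_append, Finset.mem_toList, List.mem_cons, List.not_mem_nil,
      Finset.mem_sdiff, Finset.mem_insert] at this ⊢
    tauto
  have hlen : L.length ≤ 7 := by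
    have := Finset.card_sdiff_add_card_eq_card hTS
    simp only [hL, List.length_append, Finset.length_toList, List.length_cons, List.length_nil]
    omega
  have hidx : ∀ v ∈ S, L.idxOf v < 7 := fun v hv =>
    (List.idxOf_lt_length_of_mem ((hmem v).2 hv)).trans_le hlen
  let φ : V → Fin 7 := fun v => Fin.ofNat 7 (L.idxOf v)
  have hφv : ∀ v ∈ S, (φ v : ℕ) = L.idxOf v := fun v hv => Nat.mod_eq_of_lt (hidx v hv)
  have hφ : Set.InjOn φ S := fun v hv w hw e => by
    have : L.idxOf v = L.idxOf w := by rw [← hφv v hv, ← hφv w hw, e]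
    exact (List.idxOf_inj ((hmem v).2 hv)).1 this
  have hφr : ∀ v ∈ r, (φ v : ℕ) < d := fun v hv => by
    rw [hφv v (hS _ ha.1 (by simp [hv])), hL, List.idxOf_append_of_mem (by simpa), ← hr,
      ← Finset.length_toList]
    exact List.idxOf_lt_length_of_mem (by simpa)
  have hφa : ∀ v ∉ r, v ∈ S → (φ v : ℕ) = d + ([x, y, z] ++ (S \ T).toList).idxOf v :=
    fun v hv hvS => by
      rw [hφv v hvS, hL, List.idxOf_append_of_notMem (by simpa), Finset.length_toList, hr]
  have facet : ∀ (v : V) (j : ℕ), insert v r ∈ F → v ∉ r → j < 3 →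
      ([x, y, z] ++ (S \ T).toList).idxOf v = j →
      initialFacet d j ∈ F.image (Finset.image φ) := fun v j hvF hv hj hvj => by
    refine Finset.mem_image.2 ⟨insert v r, hvF, Finset.eq_of_subset_of_card_le ?_ ?_⟩
    · intro w hw
      obtain ⟨u, hu, rfl⟩ := Finset.mem_image.1 hw
      rw [initialFacet, Finset.mem_filter]
      refine ⟨Finset.mem_univ _, ?_⟩
      rcases Finset.mem_insert.1 hu with rfl | hu
      · exact .inr (by rw [hφa u hv (hS _ hvF (by simp)), hvj])
      · exact .inl (hφr u hu)
    · rw [card_initialFacet (by omega), Finset.card_image_of_injOn (hφ.mono (hS _ hvF)),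
        h.card_eq _ hvF]
  refine not_isRigidFamily_of_initialFacet hd (by omega) (F := F.image (Finset.image φ)) ?_
    (h.image hS hφ)
  intro j hj
  interval_cases j
  · exact facet x 0 ha.1 hx (by norm_num) (by simp)
  · exact facet y 1 hb.1 hy (by norm_num) (by simp [List.idxOf_cons_ne, hab])
  · exact facet z 2 hc.1 hz (by norm_num) (by simp [List.idxOf_cons_ne, hac, hbc])

end RidgeSearch

/-! ### Acyclic complexes under collapses, and the induction. -/

namespace PreAbstractSimplicialComplex

variable {V : Type*}

theorem singleton_mem {K : PreAbstractSimplicialComplex V} {s : Finset V} (hs : s ∈ K.faces) {v : V}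
    (hv : v ∈ s) : {v} ∈ K.faces :=
  (K.isRelLowerSet_faces hs).2 (Finset.singleton_subset_iff.2 hv) (Finset.singleton_nonempty v)

theorem subset_vertexSet {K : PreAbstractSimplicialComplex V} {s : Finset V} (hs : s ∈ K.faces) :
    (s : Set V) ⊆ K.vertexSet := fun _ hv => singleton_mem hs hv

theorem finite_faces {K : PreAbstractSimplicialComplex V} (h : K.vertexSet.Finite) :
    K.faces.Finite := by
  refine (Finset.finite_toSet h.toFinset.powerset).subset fun s hs => ?_
  simpa [← Finset.coe_subset] using subset_vertexSet hs

/-- The complex obtained by removing a free face and the face that contains it. -/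
def removeFree (K : PreAbstractSimplicialComplex V) {τ σ : Finset V} (h : K.IsFreeFace τ σ) :
    PreAbstractSimplicialComplex V where
  faces := K.faces \ {τ, σ}
  isRelLowerSet_faces := by
    rintro s ⟨hs, hne⟩
    refine ⟨(K.isRelLowerSet_faces hs).1, fun b hb hbne => ?_⟩
    refine ⟨(K.isRelLowerSet_faces hs).2 hb hbne, ?_⟩
    simp only [Set.mem_insert_iff, Set.mem_singleton_iff, not_or] at hne ⊢
    constructor
    · rintro rfl
      exact hne.2 (h.2.2.2 s hs (lt_of_le_of_ne hb (Ne.symm hne.1)))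
    · rintro rfl
      exact hne.2 (h.2.2.2 s hs (h.2.2.1.trans_le hb))

theorem chains_mono {K L : PreAbstractSimplicialComplex V} (h : L.faces ⊆ K.faces) (n : ℕ) :
    L.chains n ≤ K.chains n :=
  Finsupp.supported_mono fun _ hs => ⟨hs.1, hs.2.imp_right fun h' => h h'⟩

theorem mem_chains {K : PreAbstractSimplicialComplex V} {n : ℕ} {c : Finset V →₀ ZMod 2} :
    c ∈ K.chains n ↔ ∀ s, c s ≠ 0 → s.card = n ∧ (s = ∅ ∨ s ∈ K.faces) := by
  rw [chains, Finsupp.mem_supported]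
  exact forall_congr' fun s => by simp

variable [DecidableEq V]

theorem boundary_single_apply (s t : Finset V) :
    boundary V (Finsupp.single s 1) t = if t ⊆ s ∧ s.card = t.card + 1 then 1 else 0 := by
  rw [boundary_single, Finsupp.finsetSum_apply]
  split_ifs with h
  · obtain ⟨v, hv, rfl⟩ := Finset.covBy_iff_exists_insert.1
      (Finset.covBy_iff_card_sdiff_eq_one.2 ⟨h.1, by
        rw [Finset.card_sdiff_of_subset h.1, h.2]; omega⟩)
    rw [Finset.sum_eq_single v]
    · simp [Finset.erase_insert hv]
    · intro w hw hwv
      rw [Finsupp.single_apply, if_neg]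
      intro e
      have : w ∈ t := (Finset.mem_insert.1 hw).resolve_left hwv
      rw [← e] at this
      simp at this
    · simp
  · refine Finset.sum_eq_zero fun v hv => ?_
    rw [Finsupp.single_apply, if_neg]
    rintro rfl
    exact h ⟨Finset.erase_subset _ _, (Finset.card_erase_add_one hv).symm⟩

theorem boundary_apply (c : Finset V →₀ ZMod 2) (t : Finset V) :
    boundary V c t = c.sum fun s a => if t ⊆ s ∧ s.card = t.card + 1 then a else 0 := by
  have : boundary V c = c.sum fun s a => a • boundary V (Finsupp.single s 1) := by
    conv_lhs => rw [← Finsupp.sum_single c]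
    rw [Finsupp.sum, map_sum, Finsupp.sum]
    refine Finset.sum_congr rfl fun s _ => ?_
    rw [← map_smul, Finsupp.smul_single, smul_eq_mul, mul_one]
  rw [this, Finsupp.sum, Finsupp.finsetSum_apply, Finsupp.sum]
  refine Finset.sum_congr rfl fun s _ => ?_
  rw [Finsupp.smul_apply, boundary_single_apply]
  split_ifs <;> simp

/-- A cycle of the smaller complex bounds a chain `c` in `K`, and `c` can be moved off `τ` and `σ`
without changing its boundary. -/
theorem IsAcyclic.removeFree {K : PreAbstractSimplicialComplex V} (hK : K.IsAcyclic)
    {τ σ : Finset V} (h : K.IsFreeFace τ σ) (hcard : σ.card = τ.card + 1) :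
    (K.removeFree h).IsAcyclic := by
  intro q
  have hsub : (K.removeFree h).faces ⊆ K.faces := Set.sdiff_subset
  have hτ0 : τ ≠ ∅ := (K.isRelLowerSet_faces h.1).1.ne_empty
  have hσ0 : σ ≠ ∅ := (K.isRelLowerSet_faces h.2.1).1.ne_empty
  have hτ : ∀ {n c}, c ∈ (K.removeFree h).chains n → c τ = 0 := fun {n c} hc => by
    by_contra h0
    rcases (mem_chains.1 hc τ h0).2 with h | h
    exacts [hτ0 h, h.2 (by simp)]
  have lift : ∀ {n c}, c ∈ K.chains n → c τ = 0 → c σ = 0 → c ∈ (K.removeFree h).chains n := by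
    intro n c hc h1 h2
    refine mem_chains.2 fun s hs => ⟨(mem_chains.1 hc s hs).1, (mem_chains.1 hc s hs).2.imp_right
      fun hsK => ⟨hsK, ?_⟩⟩
    rintro (rfl | rfl)
    exacts [hs h1, hs h2]
  have zero_of_card : ∀ {n c s}, c ∈ K.chains n → s.card ≠ n → c s = 0 := fun hc hs => by
    by_contra h0
    exact hs (mem_chains.1 hc _ h0).1
  refine le_antisymm ?_ (boundaries_le_cycles _ q)
  rintro z ⟨hz, hz0⟩
  have hzK : z ∈ K.boundaries q := by
    rw [← hK q]
    exact ⟨chains_mono hsub _ hz, hz0⟩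
  obtain ⟨c, hc, rfl⟩ := hzK
  -- If `c` lives in the dimension of `τ`, adding `c τ` times the boundary of `σ` cancels `τ`.
  -- Otherwise `c` avoids `τ`; as `σ` is the only face above `τ`, the coefficient of `τ` in the
  -- boundary is `c σ`, which vanishes because the cycle avoids `τ`.
  by_cases h1 : q + 2 = τ.card
  · have hb : boundary V (Finsupp.single σ 1) ∈ K.chains (q + 2) := by
      refine (boundaries_le_cycles K (q + 1) ⟨Finsupp.single σ 1, ?_, rfl⟩).1
      exact Finsupp.single_mem_supported _ _ ⟨by omega, .inr h.2.1⟩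
    refine ⟨c + c τ • boundary V (Finsupp.single σ 1), lift ?_ ?_ ?_, ?_⟩
    · exact Submodule.add_mem _ hc (Submodule.smul_mem _ _ hb)
    · rw [Finsupp.add_apply, Finsupp.smul_apply, boundary_single_apply,
        if_pos ⟨h.2.2.1.subset, hcard⟩, smul_eq_mul, mul_one, CharTwo.add_self_eq_zero]
    · rw [Finsupp.add_apply, Finsupp.smul_apply, zero_of_card hc (by omega),
        zero_of_card hb (by omega), smul_zero, zero_add]
    · rw [map_add, map_smul, boundary_boundary, smul_zero, add_zero]
  · have hcτ : c τ = 0 := zero_of_card hc (Ne.symm h1)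
    refine ⟨c, lift hc hcτ ?_, rfl⟩
    by_contra hcσ
    have := hτ hz
    rw [boundary_apply, Finsupp.sum, Finset.sum_eq_single σ] at this
    · rw [if_pos ⟨h.2.2.1.subset, hcard⟩] at this
      exact hcσ this
    · intro s hs hsσ
      rw [if_neg]
      rintro ⟨hτs, hscard⟩
      rcases (mem_chains.1 hc s (Finsupp.mem_support_iff.1 hs)).2 with rfl | hsK
      · simp at hscard
      · refine hsσ (h.2.2.2 s hsK (Finset.ssubset_iff_subset_ne.2 ⟨hτs, ?_⟩))
        rintro rfl
        omega
    · intro h0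
      exact absurd (Finsupp.notMem_support_iff.1 h0) hcσ

/-- In an acyclic complex no non-empty set of faces of top dimension is a cycle. -/
theorem IsAcyclic.eq_empty_of_even {K : PreAbstractSimplicialComplex V} (hK : K.IsAcyclic) {d : ℕ}
    (hd : ∀ s ∈ K.faces, s.card ≤ d + 1) {G : Finset (Finset V)}
    (hG : ∀ s ∈ G, s ∈ K.faces ∧ s.card = d + 1)
    (heven : ∀ r : Finset V, r.card = d → ¬ Odd (G.filter fun s => r ⊆ s).card) : G = ∅ := by
  have hcyc : ∑ s ∈ G, Finsupp.single s (1 : ZMod 2) ∈ K.cycles d := by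
    refine ⟨Submodule.sum_mem _ fun s hs => Finsupp.single_mem_supported _ _
      ⟨(hG s hs).2, .inr (hG s hs).1⟩, ?_⟩
    rw [SetLike.mem_coe, LinearMap.mem_ker, map_sum]
    ext1 t
    rw [Finsupp.finsetSum_apply, Finsupp.zero_apply]
    by_cases ht : t.card = d
    · have : ∀ s ∈ G, boundary V (Finsupp.single s 1) t = if t ⊆ s then 1 else 0 := fun s hs => by
        rw [boundary_single_apply, (hG s hs).2, ht]
        simp
      rw [Finset.sum_congr rfl this, Finset.sum_boole, ZMod.natCast_eq_zero_iff_even]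
      exact Nat.not_odd_iff_even.1 (heven t ht)
    · refine Finset.sum_eq_zero fun s hs => ?_
      rw [boundary_single_apply, if_neg]
      rintro ⟨-, h⟩
      have := (hG s hs).2
      omega
  rw [hK d] at hcyc
  obtain ⟨c, hc, hcG⟩ := hcyc
  have hc0 : c = 0 := by
    ext1 s
    by_contra h0
    obtain ⟨hs, rfl | hsK⟩ := mem_chains.1 hc s h0
    · simp at hs
    · have := hd s hsK
      omega
  rw [hc0, map_zero] at hcG
  refine Finset.eq_empty_of_forall_notMem fun s hs => ?_
  have := DFunLike.congr_fun hcG s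
  rw [Finsupp.zero_apply, Finsupp.finsetSum_apply, Finset.sum_eq_single s] at this
  · simp at this
  · intro t _ hts
    rw [Finsupp.single_apply, if_neg hts]
  · exact fun h => absurd hs h

theorem IsAcyclic.isCollapsible {K : PreAbstractSimplicialComplex V} (hne : K.faces.Nonempty)
    (hcard : K.vertexSet.encard ≤ 7) (hK : K.IsAcyclic) : K.IsCollapsible := by
  have hfin : K.vertexSet.Finite := Set.finite_of_encard_le_coe hcard
  have hfaces := finite_faces hfin
  induction hn : K.faces.ncard using Nat.strong_induction_on generalizing K with
  | _ n ih =>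
    obtain ⟨s₀, hs₀, hmax⟩ := Set.exists_max_image K.faces Finset.card hfaces hne
    obtain ⟨d, hd⟩ : ∃ d, s₀.card = d + 1 := Nat.exists_eq_add_one.2
      (Finset.card_pos.2 (K.isRelLowerSet_faces hs₀).1)
    rw [hd] at hmax
    set F := hfaces.toFinset.filter fun s => s.card = d + 1 with hF
    have memF : ∀ s, s ∈ F ↔ s ∈ K.faces ∧ s.card = d + 1 := fun s => by simp [hF]
    have hcyc : ∀ G ⊆ F, (∀ r : Finset V, r.card = d → ¬ Odd (G.filter fun s => r ⊆ s).card) →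
        G = ∅ := fun G hG => hK.eq_empty_of_even hmax fun s hs => (memF s).1 (hG hs)
    rcases Nat.eq_zero_or_pos d with rfl | hdpos
    · obtain ⟨v, rfl⟩ := Finset.card_eq_one.1 hd
      refine ⟨K, v, .refl, Set.eq_singleton_iff_unique_mem.2 ⟨hs₀, fun t ht => ?_⟩⟩
      have ht1 : t.card = 1 := le_antisymm (hmax t ht)
        (Finset.card_pos.2 (K.isRelLowerSet_faces ht).1)
      by_contra htv
      -- For `d = 0` the only ridge is the empty set, so two distinct vertices would form a reduced
      -- cycle.
      have := hcyc {t, {v}} (by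
        intro s hs
        rw [Finset.mem_insert, Finset.mem_singleton] at hs
        rcases hs with rfl | rfl
        exacts [(memF _).2 ⟨ht, ht1⟩, (memF _).2 ⟨hs₀, hd⟩]) (by
        intro r hr
        rw [Finset.card_eq_zero.1 hr, Finset.filter_true_of_mem (by simp),
          Finset.card_pair htv]
        decide)
      simp at this
    · by_cases hfree : ∃ s ∈ F, ∃ r ⊆ s, r.card = d ∧ ∀ t ∈ F, r ⊆ t → t = s
      · obtain ⟨s, hs, r, hrs, hr, huniq⟩ := hfree
        obtain ⟨hsK, hscard⟩ := (memF s).1 hs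
        have hrne : r ≠ s := fun e => by rw [e] at hr; omega
        -- By maximality of the dimension, every face properly containing a ridge is a facet.
        have hfree : K.IsFreeFace r s := by
          refine ⟨(K.isRelLowerSet_faces hsK).2 hrs (Finset.card_pos.1 (hr ▸ hdpos)), hsK,
            Finset.ssubset_iff_subset_ne.2 ⟨hrs, hrne⟩, fun ρ hρ hrρ => ?_⟩
          have h1 := Finset.card_lt_card hrρ
          have h2 := hmax ρ hρ
          exact huniq ρ ((memF ρ).2 ⟨hρ, by omega⟩) hrρ.subset
        have hsub : (K.removeFree hfree).faces ⊆ K.faces := Set.sdiff_subset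
        have hvert : (K.removeFree hfree).vertexSet ⊆ K.vertexSet := fun v hv => hsub hv
        obtain ⟨v, hvs, hvr⟩ := Finset.exists_of_ssubset hfree.2.2.1
        obtain ⟨L, w, hL, hLw⟩ := ih _ (hn ▸ Set.ncard_lt_ncard
            (Set.ssubset_iff_subset_ne.2 ⟨hsub, fun e => (e ▸ hsK).2 (by simp)⟩) hfaces)
          (K := K.removeFree hfree)
          -- A vertex of `s` outside `r` survives: it is not `r`, and `s` has at least two vertices
          -- because `d > 0`.
          ⟨{v}, singleton_mem hsK hvs, by
            rintro (rfl | rfl)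
            · simp at hvr
            · simp at hscard; omega⟩
          ((Set.encard_le_encard hvert).trans hcard) (hK.removeFree hfree (by omega))
          (hfin.subset hvert) (hfaces.subset hsub) rfl
        exact ⟨L, w, .head ⟨r, s, hfree, rfl⟩ hL, hLw⟩
      · exfalso
        push Not at hfree
        refine RidgeSearch.not_isRigidFamily hdpos ⟨s₀, (memF _).2 ⟨hs₀, hd⟩⟩
          (S := hfin.toFinset) (fun s hs => ?_) ?_ ⟨fun s hs => ((memF s).1 hs).2, ?_, hcyc⟩
        · simpa [← Finset.coe_subset] using subset_vertexSet ((memF s).1 hs).1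
        · rw [hfin.encard_eq_coe_toFinset_card] at hcard
          exact_mod_cast hcard
        · intro s hs r hrs hr
          obtain ⟨t, ht, hrt, hts⟩ := hfree s hs r hrs hr
          exact ⟨t, ht, hts, hrt⟩

end PreAbstractSimplicialComplex

/-! ### Testing acyclicity away from one vertex. -/

namespace PreAbstractSimplicialComplex

/-- A cycle that vanishes on all faces avoiding a vertex is zero. -/
theorem eq_zero_of_avoid {V : Type*} [DecidableEq V] {K : PreAbstractSimplicialComplex V} {q : ℕ}
    {z : Finset V →₀ ZMod 2} (hz : z ∈ K.cycles q) (v : V)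
    (h : ∀ s ∈ K.faces, s.card = q + 1 → v ∉ s → z s = 0) : z = 0 := by
  have h' : ∀ s, v ∉ s → z s = 0 := fun s hv => by
    by_contra h0
    obtain ⟨hcard, rfl | hs⟩ := mem_chains.1 hz.1 s h0
    · simp at hcard
    · exact h0 (h s hs hcard hv)
  ext1 s
  by_cases hv : v ∈ s
  · have hb : boundary V z (s.erase v) = 0 := by
      rw [LinearMap.mem_ker.1 hz.2]; rfl
    rw [boundary_apply, Finsupp.sum, Finset.sum_eq_single s] at hb
    · rwa [if_pos ⟨Finset.erase_subset _ _, (Finset.card_erase_add_one hv).symm⟩] at hb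
    · intro t ht hts
      rw [if_neg]
      rintro ⟨hsub, hcard⟩
      refine Finsupp.mem_support_iff.1 ht (h' t fun hvt => hts ?_)
      refine (Finset.eq_of_subset_of_card_le (fun x hx => ?_) ?_).symm
      · by_cases hxv : x = v
        · exact hxv ▸ hvt
        · exact hsub (Finset.mem_erase.2 ⟨hxv, hx⟩)
      · rw [hcard, Finset.card_erase_add_one hv]
    · intro h0
      rw [Finsupp.notMem_support_iff.1 h0, ite_self]
  · exact h' s hv

/-- A cycle is determined by its values on the faces avoiding `v`, so a chain need only have the
right boundary there. -/
theorem isAcyclic_of_exists_avoid {V : Type*} [DecidableEq V] {K : PreAbstractSimplicialComplex V}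
    (v : V) (h : ∀ q, ∀ z ∈ K.cycles q, ∃ c ∈ K.chains (q + 2), ∀ s ∈ K.faces, s.card = q + 1 →
      v ∉ s → boundary V c s = z s) : K.IsAcyclic := by
  intro q
  refine le_antisymm (fun z hz => ?_) (boundaries_le_cycles K q)
  obtain ⟨c, hc, hcz⟩ := h q z hz
  have hb : boundary V c ∈ K.boundaries q := ⟨c, hc, rfl⟩
  have : boundary V c - z = 0 := eq_zero_of_avoid
    (Submodule.sub_mem _ (boundaries_le_cycles K q hb) hz) v fun s hs hcard hv => by
      rw [Finsupp.sub_apply, hcz s hs hcard hv, sub_self]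
  rwa [← sub_eq_zero.1 this]

end PreAbstractSimplicialComplex

/-! ### The eight-vertex Dunce Hat: acyclic, without free faces. -/

namespace DunceHatTriangulation

open PreAbstractSimplicialComplex

/-- The triangles of a triangulated disc with vertices `0, …, 13`, of which `0, …, 8` are on the
boundary, counterclockwise. -/
def tri : Fin 17 → Fin 3 → Fin 14 :=
  ![![0, 10, 9], ![0, 1, 10], ![1, 2, 10], ![2, 11, 10], ![2, 3, 11], ![3, 4, 11], ![4, 12, 11],
    ![4, 5, 12], ![5, 6, 12], ![6, 13, 12], ![6, 7, 13], ![7, 9, 13], ![7, 8, 9], ![8, 0, 9],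
    ![10, 11, 12], ![10, 12, 13], ![10, 13, 9]]

/-- The identifications of the vertices of the disc that produce the Dunce Hat. -/
def label : Fin 14 → Fin 8 := ![0, 1, 2, 0, 1, 2, 0, 2, 1, 3, 4, 5, 6, 7]

/-- The triangles of the triangulated Dunce Hat. -/
def facet (t : Fin 17) : Finset (Fin 8) := Finset.univ.image fun v => label (tri t v)

/-- The edges of the triangulated Dunce Hat that avoid the vertex `0`. -/
def outerEdge : Fin 17 → Finset (Fin 8) :=
  ![{1, 2}, {1, 3}, {1, 4}, {1, 5}, {1, 6}, {2, 3}, {2, 4}, {2, 5}, {2, 6}, {2, 7}, {3, 4}, {3, 7},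
    {4, 5}, {4, 6}, {4, 7}, {5, 6}, {6, 7}]

/-- The incidences of the edges that avoid the vertex `0` with the triangles. -/
def incidence (e t : Fin 17) : ZMod 2 := if outerEdge e ⊆ facet t then 1 else 0

/-- The inverse of the incidence matrix, with rows coded in binary. -/
def incidenceInv (t e : Fin 17) : ZMod 2 :=
  if Nat.testBit (![40049, 59445, 59441, 59505, 59633, 30841, 30833, 30817, 31073, 120945, 37489,
    36977, 36945, 36947, 63601, 55409, 39025] t) e then 1 else 0

/-- As a right inverse the matrix fills 1-cycles by triangles; as a left inverse, in
`inv_mul_incidence`, it kills 2-cycles. -/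
theorem incidence_mul_inv (e e' : Fin 17) :
    ∑ t, incidence e t * incidenceInv t e' = if e = e' then 1 else 0 := by
  revert e e'
  decide +kernel

theorem inv_mul_incidence (t t' : Fin 17) :
    ∑ e, incidenceInv t e * incidence e t' = if t = t' then 1 else 0 := by
  revert t t'
  decide +kernel

/-- A triangulation of the Dunce Hat with eight vertices. -/
def dunceHat : PreAbstractSimplicialComplex (Fin 8) where
  faces := {s | s.Nonempty ∧ ∃ t, s ⊆ facet t}
  isRelLowerSet_faces := by
    rintro s ⟨hs, t, ht⟩
    exact ⟨hs, fun b hb hne => ⟨hne, t, hb.trans ht⟩⟩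

theorem card_facet (t : Fin 17) : (facet t).card = 3 := by
  revert t
  decide +kernel

theorem facet_injective : Function.Injective facet := by
  have : ∀ t t', facet t = facet t' → t = t' := by decide +kernel
  exact fun t t' => this t t'

theorem card_outerEdge (e : Fin 17) : (outerEdge e).card = 2 := by
  revert e
  decide +kernel

theorem exists_eq_outerEdge (s : Finset (Fin 8)) (hs : s.card = 2) (h0 : 0 ∉ s)
    (h : ∃ t, s ⊆ facet t) : ∃ e, s = outerEdge e := by
  revert s
  decide +kernel

theorem exists_insert_zero_subset (v : Fin 8) : ∃ t, {0, v} ⊆ facet t := by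
  revert v
  decide +kernel

theorem card_le {s : Finset (Fin 8)} (hs : s ∈ dunceHat.faces) : s.card ≤ 3 := by
  obtain ⟨-, t, ht⟩ := hs
  exact card_facet t ▸ Finset.card_le_card ht

theorem facet_mem (t : Fin 17) : facet t ∈ dunceHat.faces :=
  ⟨Finset.card_pos.1 (by rw [card_facet]; norm_num), t, subset_rfl⟩

theorem exists_eq_facet {s : Finset (Fin 8)} (hs : s ∈ dunceHat.faces) (h : s.card = 3) :
    ∃ t, s = facet t := by
  obtain ⟨-, t, ht⟩ := hs
  exact ⟨t, Finset.eq_of_subset_of_card_le ht (by rw [card_facet, h])⟩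

theorem boundary_facet (a : Fin 17 → ZMod 2) (e : Fin 17) :
    boundary (Fin 8) (∑ t, a t • Finsupp.single (facet t) 1) (outerEdge e) =
      ∑ t, incidence e t * a t := by
  rw [map_sum, Finsupp.finsetSum_apply]
  refine Finset.sum_congr rfl fun t _ => ?_
  rw [map_smul, Finsupp.smul_apply, boundary_single_apply, incidence, card_facet, card_outerEdge,
    smul_eq_mul, mul_comm]
  simp

theorem isAcyclic_dunceHat : dunceHat.IsAcyclic := by
  refine isAcyclic_of_exists_avoid 0 fun q z hz => ?_
  have z_eq_zero : 3 ≤ q → z = 0 := fun hq => by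
    ext1 s
    by_contra h0
    obtain ⟨hcard, rfl | hs⟩ := mem_chains.1 hz.1 s h0
    · simp at hcard
    · have := card_le hs
      omega
  match q, z_eq_zero with
  | 0, _ =>
    -- Vertex `0` is adjacent to all others, so each `v ≠ 0` is joined to it by an edge.
    refine ⟨∑ v ∈ Finset.univ.erase (0 : Fin 8), z {v} • Finsupp.single {0, v} 1, ?_, ?_⟩
    · refine Submodule.sum_mem _ fun v hv => Submodule.smul_mem _ _
        (Finsupp.single_mem_supported _ _ ⟨Finset.card_pair (Finset.ne_of_mem_erase hv).symm,
          .inr ⟨Finset.insert_nonempty _ _, exists_insert_zero_subset v⟩⟩)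
    · intro s _ hcard h0
      obtain ⟨u, rfl⟩ := Finset.card_eq_one.1 hcard
      have hu : u ≠ 0 := fun e => h0 (by simp [e])
      rw [map_sum, Finsupp.finsetSum_apply, Finset.sum_eq_single u]
      · rw [map_smul, Finsupp.smul_apply, boundary_single_apply, if_pos]
        · simp
        · exact ⟨by simp, Finset.card_pair hu.symm⟩
      · intro v _ hvu
        rw [map_smul, Finsupp.smul_apply, boundary_single_apply, if_neg, smul_zero]
        rintro ⟨hsub, -⟩
        simp [hu, Ne.symm hvu] at hsub
      · exact fun h => absurd (Finset.mem_erase.2 ⟨hu, Finset.mem_univ u⟩) h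
  | 1, _ =>
    refine ⟨∑ t, (∑ e, incidenceInv t e * z (outerEdge e)) • Finsupp.single (facet t) 1, ?_, ?_⟩
    · exact Submodule.sum_mem _ fun t _ => Submodule.smul_mem _ _
        (Finsupp.single_mem_supported _ _ ⟨card_facet t, .inr (facet_mem t)⟩)
    · intro s hs hcard h0
      obtain ⟨e, rfl⟩ := exists_eq_outerEdge s hcard h0 hs.2
      rw [boundary_facet]
      simp_rw [Finset.mul_sum, ← mul_assoc]
      rw [Finset.sum_comm]
      simp_rw [← Finset.sum_mul, incidence_mul_inv]
      simp
  | 2, _ =>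
    have hz' : z = ∑ t, z (facet t) • Finsupp.single (facet t) 1 := by
      ext1 s
      rw [Finsupp.finsetSum_apply]
      by_cases hs : ∃ t, s = facet t
      · obtain ⟨t, rfl⟩ := hs
        rw [Finset.sum_eq_single t]
        · simp
        · intro t' _ ht'
          rw [Finsupp.smul_apply, Finsupp.single_apply, if_neg fun e => ht' (facet_injective e),
            smul_zero]
        · simp
      · rw [Finset.sum_eq_zero]
        · by_contra h0
          obtain ⟨hcard, rfl | hsK⟩ := mem_chains.1 hz.1 s h0
          · simp at hcard
          · exact hs (exists_eq_facet hsK hcard)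
        · intro t _
          rw [Finsupp.smul_apply, Finsupp.single_apply, if_neg fun e => hs ⟨t, e.symm⟩, smul_zero]
    have hsum : ∀ e, ∑ t, incidence e t * z (facet t) = 0 := fun e => by
      rw [← boundary_facet, ← hz', LinearMap.mem_ker.1 hz.2]
      rfl
    have hz0 : ∀ t, z (facet t) = 0 := fun t => by
      calc z (facet t) = ∑ t', (if t = t' then 1 else 0) * z (facet t') := by simp
        _ = ∑ e, incidenceInv t e * ∑ t', incidence e t' * z (facet t') := by
          simp_rw [← inv_mul_incidence, Finset.mul_sum, Finset.sum_mul, mul_assoc]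
          exact Finset.sum_comm
        _ = 0 := by simp [hsum]
    refine ⟨0, Submodule.zero_mem _, fun s hs hcard _ => ?_⟩
    obtain ⟨t, rfl⟩ := exists_eq_facet hs hcard
    rw [map_zero, hz0]
    rfl
  | q + 3, h =>
    refine ⟨0, Submodule.zero_mem _, fun s _ _ _ => ?_⟩
    rw [h (by omega), map_zero]

/-- This excludes free faces altogether, so not even a first collapse exists. -/
theorem exists_two_facets (s : Finset (Fin 8)) (hs : s.Nonempty) (h : ∃ t, s ⊂ facet t) :
    ∃ t t', s ⊂ facet t ∧ s ⊂ facet t' ∧ t ≠ t' := by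
  revert s
  decide +kernel

theorem vertexSet_dunceHat : dunceHat.vertexSet = Set.univ := by
  refine Set.eq_univ_of_forall fun v => ⟨Finset.singleton_nonempty v, ?_⟩
  obtain ⟨t, ht⟩ := exists_insert_zero_subset v
  exact ⟨t, (Finset.subset_insert _ _).trans ht⟩

theorem encard_vertexSet_dunceHat : dunceHat.vertexSet.encard = 8 := by
  rw [vertexSet_dunceHat, Set.encard_univ]
  simp

theorem not_isCollapsible_dunceHat : ¬ dunceHat.IsCollapsible := by
  rintro ⟨L, v, hL, hv⟩
  rcases Relation.ReflTransGen.cases_head hL with rfl | ⟨M, ⟨τ, σ, ⟨hτ, hσ, hτσ, huniq⟩, -⟩, -⟩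
  · have h := facet_mem 0
    have h' := card_facet 0
    rw [hv, Set.mem_singleton_iff] at h
    rw [h] at h'
    simp at h'
  · obtain ⟨-, t, ht⟩ := hσ
    obtain ⟨t₁, t₂, h₁, h₂, hne⟩ := exists_two_facets τ hτ.1 ⟨t, hτσ.trans_subset ht⟩
    exact hne (facet_injective ((huniq _ (facet_mem t₁) h₁).trans (huniq _ (facet_mem t₂) h₂).symm))

end DunceHatTriangulation

namespace DunceHatTriangulation

open PreAbstractSimplicialComplex

/-! ### The triangulated disc as a geometric triangulation of the triangle -/

/-- The barycentric coordinates of the vertices of the disc in the triangle, multiplied by `6`. -/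
def pos : Fin 14 → Fin 3 → ℤ :=
  ![![6, 0, 0], ![4, 2, 0], ![2, 4, 0], ![0, 6, 0], ![0, 4, 2], ![0, 2, 4], ![0, 0, 6], ![2, 0, 4],
    ![4, 0, 2], ![3, 1, 2], ![3, 2, 1], ![1, 4, 1], ![1, 2, 3], ![2, 1, 3]]

/-- The values at the vertices of a convex function that is linear exactly on the triangles. -/
def height : Fin 14 → ℤ := ![6, 3, 2, 6, 4, 4, 5, 3, 4, 1, 0, 2, 1, 1]

/-- The coefficients of the linear form that vanishes on the edge opposite to the `v`-th vertex of
the triangle `t`. -/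
def bary (t : Fin 17) (v k : Fin 3) : ℤ :=
  pos (tri t (v + 1)) (k + 1) * pos (tri t (v + 2)) (k + 2) -
    pos (tri t (v + 1)) (k + 2) * pos (tri t (v + 2)) (k + 1)

/-- Twice the area of a triangle, up to a constant factor. -/
def area (t : Fin 17) : ℤ := ∑ k, bary t 0 k * pos (tri t 0) k

/-- The linear form that interpolates `height` on a triangle, multiplied by the area. -/
def interp (t : Fin 17) (k : Fin 3) : ℤ := ∑ v, height (tri t v) * bary t v k

theorem area_pos (t : Fin 17) : 0 < area t := by
  revert t
  decide +kernel

theorem sum_bary_mul_pos (t : Fin 17) (v w : Fin 3) :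
    ∑ k, bary t v k * pos (tri t w) k = if v = w then area t else 0 := by
  revert t v w
  decide +kernel

/-- `bary t` is the adjugate of the matrix of vertex positions of `t` and `area t` its determinant;
this and `sum_bary_mul_pos` are the two adjugate identities. -/
theorem sum_pos_mul_bary (t : Fin 17) (k j : Fin 3) :
    ∑ v, bary t v k * pos (tri t v) j = if k = j then area t else 0 := by
  revert t k j
  decide +kernel

/-- Convexity of `height`: the linear form of each triangle lies below it at all vertices, with
equality, by `interp_eq_iff`, only at the corners of that triangle. -/
theorem interp_le (t : Fin 17) (i : Fin 14) : ∑ k, interp t k * pos i k ≤ area t * height i := by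
  revert t i
  decide +kernel

theorem interp_eq_iff (t : Fin 17) (i : Fin 14) :
    ∑ k, interp t k * pos i k = area t * height i ↔ ∃ v, tri t v = i := by
  revert t i
  decide +kernel

theorem sum_pos (i : Fin 14) : ∑ k, pos i k = 6 := by
  revert i
  decide +kernel

theorem tri_injective (t : Fin 17) : Function.Injective (tri t) := by
  have : ∀ t v w, tri t v = tri t w → v = w := by decide +kernel
  exact fun v w => this t v w

theorem label_tri_injective (t : Fin 17) : Function.Injective fun v => label (tri t v) := by
  have : ∀ t v w, label (tri t v) = label (tri t w) → v = w := by decide +kernel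
  exact fun v w => this t v w

/-- Each side of a triangle is on the boundary, or it is a side of another triangle, on which
`interp` is given by a linear form that is larger on the other side. -/
theorem boundary_or_interior (t : Fin 17) (v : Fin 3) :
    (∃ j, 0 ≤ bary t v j ∧ ∀ k, k ≠ j → bary t v k = 0) ∨
    ∃ t', 0 < ∑ k, (area t' * interp t k - area t * interp t' k) * pos (tri t v) k ∧
      ∀ k, area t * (area t' * interp t k - area t * interp t' k) =
        (∑ k, (area t' * interp t k - area t * interp t' k) * pos (tri t v) k) * bary t v k := by
  revert t v
  decide +kernel

/-- A function on the vertices of the disc is supported on a triangle. -/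
def SupportedOn (t : Fin 17) (x : Fin 14 → ℝ) : Prop := ∀ i, x i ≠ 0 → ∃ v, tri t v = i

/-- The carrier of the triangulated disc. -/
def disc : Set (Fin 14 → ℝ) := {x | x ∈ stdSimplex ℝ (Fin 14) ∧ ∃ t, SupportedOn t x}

/-- The function with values `a` on the vertices of a triangle that vanishes elsewhere. -/
def onTri (t : Fin 17) (a : Fin 3 → ℝ) (i : Fin 14) : ℝ := ∑ v, if tri t v = i then a v else 0

theorem onTri_tri (t : Fin 17) (a : Fin 3 → ℝ) (v : Fin 3) : onTri t a (tri t v) = a v := by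
  simp [onTri, (tri_injective t).eq_iff]

theorem supportedOn_onTri (t : Fin 17) (a : Fin 3 → ℝ) : SupportedOn t (onTri t a) := by
  intro i hi
  by_contra! h
  exact hi (Finset.sum_eq_zero fun v _ => if_neg (h v))

theorem SupportedOn.eq_onTri {t : Fin 17} {x : Fin 14 → ℝ} (h : SupportedOn t x) :
    x = onTri t fun v => x (tri t v) := by
  ext i
  by_cases hi : ∃ v, tri t v = i
  · obtain ⟨v, rfl⟩ := hi
    rw [onTri_tri]
  · rw [not_not.1 (mt (h i) hi), not_not.1 (mt (supportedOn_onTri t _ i) hi)]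

theorem sum_onTri_mul (t : Fin 17) (a : Fin 3 → ℝ) (g : Fin 14 → ℝ) :
    ∑ i, onTri t a i * g i = ∑ v, a v * g (tri t v) := by
  simp_rw [onTri, Finset.sum_mul]
  rw [Finset.sum_comm]
  simp

theorem SupportedOn.sum_mul {t : Fin 17} {x : Fin 14 → ℝ} (h : SupportedOn t x) (g : Fin 14 → ℝ) :
    ∑ i, x i * g i = ∑ v, x (tri t v) * g (tri t v) := by
  conv_lhs => rw [h.eq_onTri]
  rw [sum_onTri_mul]

/-- The point of the triangle with given barycentric coordinates in the disc. -/
noncomputable def realize (x : Fin 14 → ℝ) (k : Fin 3) : ℝ := (∑ i, x i * (pos i k : ℝ)) / 6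

theorem continuous_realize : Continuous realize := by
  unfold realize
  fun_prop

theorem sum_mul_realize (c : Fin 3 → ℤ) (x : Fin 14 → ℝ) :
    ∑ k, (c k : ℝ) * realize x k = (∑ i, x i * ((∑ k, c k * pos i k : ℤ) : ℝ)) / 6 := by
  simp_rw [realize, mul_div_assoc', ← Finset.sum_div, Finset.mul_sum]
  rw [Finset.sum_comm]
  congr 1
  refine Finset.sum_congr rfl fun i _ => ?_
  push_cast
  rw [Finset.mul_sum]
  exact Finset.sum_congr rfl fun k _ => by ring

theorem sum_realize (x : Fin 14 → ℝ) : ∑ k, realize x k = ∑ i, x i := by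
  have := sum_mul_realize (fun _ => 1) x
  simp only [one_mul, sum_pos, Int.cast_one] at this
  rw [this, ← Finset.sum_mul]
  push_cast
  ring

theorem realize_mem {x : Fin 14 → ℝ} (hx : x ∈ stdSimplex ℝ (Fin 14)) :
    realize x ∈ stdSimplex ℝ (Fin 3) := by
  refine ⟨fun k => ?_, by rw [sum_realize, hx.2]⟩
  have hpos : ∀ i k, 0 ≤ pos i k := by decide +kernel
  have : ∀ i, (0 : ℝ) ≤ pos i k := fun i => by exact_mod_cast hpos i k
  exact div_nonneg (Finset.sum_nonneg fun i _ => mul_nonneg (hx.1 i) (this i)) (by norm_num)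

theorem SupportedOn.sum_bary {t : Fin 17} {x : Fin 14 → ℝ} (h : SupportedOn t x) (v : Fin 3) :
    ∑ k, (bary t v k : ℝ) * realize x k = x (tri t v) * area t / 6 := by
  rw [sum_mul_realize, h.sum_mul]
  simp_rw [sum_bary_mul_pos]
  simp

theorem SupportedOn.eq_of_realize_eq {t : Fin 17} {x y : Fin 14 → ℝ} (hx : SupportedOn t x)
    (hy : SupportedOn t y) (h : realize x = realize y) : x = y := by
  rw [hx.eq_onTri, hy.eq_onTri]
  congr 1
  ext v
  have h1 := hx.sum_bary v
  rw [h, hy.sum_bary v] at h1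
  have : (0 : ℝ) < area t := by exact_mod_cast area_pos t
  field_simp at h1
  exact h1.symm

theorem SupportedOn.sum_interp {t : Fin 17} {x : Fin 14 → ℝ} (h : SupportedOn t x) :
    (∑ k, (interp t k : ℝ) * realize x k) * 6 = area t * ∑ i, x i * height i := by
  rw [sum_mul_realize, div_mul_cancel₀ _ (by norm_num), h.sum_mul, h.sum_mul, Finset.mul_sum]
  refine Finset.sum_congr rfl fun v _ => ?_
  rw [(interp_eq_iff t _).2 ⟨v, rfl⟩]
  push_cast
  ring

theorem sum_interp_le (t : Fin 17) {x : Fin 14 → ℝ} (hx : ∀ i, 0 ≤ x i) :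
    (∑ k, (interp t k : ℝ) * realize x k) * 6 ≤ area t * ∑ i, x i * height i := by
  rw [sum_mul_realize, div_mul_cancel₀ _ (by norm_num), Finset.mul_sum]
  refine Finset.sum_le_sum fun i _ => ?_
  have : ((∑ k, interp t k * pos i k : ℤ) : ℝ) ≤ area t * height i := by
    exact_mod_cast interp_le t i
  nlinarith [hx i]

/-- Two representations of one point minimise the same weighted height, so their heights agree.
Equality in the convexity inequality then forces both onto one triangle, where barycentric
coordinates are unique. -/
theorem realize_injOn : Set.InjOn realize disc := by
  rintro x ⟨hx, t, ht⟩ y ⟨hy, t', ht'⟩ h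
  have ha : ∀ t, (0 : ℝ) < area t := fun t => by exact_mod_cast area_pos t
  have h1 : ∑ i, x i * (height i : ℝ) ≤ ∑ i, y i * (height i : ℝ) := by
    have := sum_interp_le t hy.1
    rw [← h, ht.sum_interp] at this
    exact le_of_mul_le_mul_left this (ha t)
  have h2 : ∑ i, y i * (height i : ℝ) ≤ ∑ i, x i * (height i : ℝ) := by
    have := sum_interp_le t' hx.1
    rw [h, ht'.sum_interp] at this
    exact le_of_mul_le_mul_left this (ha t')
  refine ht.eq_of_realize_eq (fun i hi => ?_) h
  -- The terms are non-negative, so `y` can be non-zero only where the slack vanishes, at the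
  -- corners of `t`.
  have h3 : ∑ i, y i * (area t * height i - (∑ k, interp t k * pos i k : ℤ) : ℝ) = 0 := by
    have e := ht.sum_interp
    rw [le_antisymm h1 h2, h, sum_mul_realize, div_mul_cancel₀ _ (by norm_num),
      Finset.mul_sum] at e
    simp_rw [mul_sub, Finset.sum_sub_distrib]
    rw [e, sub_eq_zero]
    exact Finset.sum_congr rfl fun i _ => by ring
  have hnonneg : ∀ i, (0 : ℝ) ≤ area t * height i - (∑ k, interp t k * pos i k : ℤ) := fun i =>
    sub_nonneg.2 (by exact_mod_cast interp_le t i)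
  have h4 := (Finset.sum_eq_zero_iff_of_nonneg fun i _ => mul_nonneg (hy.1 i) (hnonneg i)).1 h3 i
    (Finset.mem_univ i)
  refine (interp_eq_iff t i).1 ?_
  have h5 := (mul_eq_zero.1 h4).resolve_left hi
  exact_mod_cast (sub_eq_zero.1 h5).symm

theorem exists_bary_nonneg {p : Fin 3 → ℝ} (hp : p ∈ stdSimplex ℝ (Fin 3)) :
    ∃ t, ∀ v, 0 ≤ ∑ k, (bary t v k : ℝ) * p k := by
  -- The triangle whose linear form is largest at `p` contains `p`: beyond an interior side the form
  -- of the neighbour would be larger, and beyond a boundary side `p` would leave the big triangle.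
  obtain ⟨t, ht⟩ := Finite.exists_max fun t : Fin 17 => (∑ k, (interp t k : ℝ) * p k) / area t
  refine ⟨t, fun v => ?_⟩
  have ha : ∀ t, (0 : ℝ) < area t := fun t => by exact_mod_cast area_pos t
  rcases boundary_or_interior t v with ⟨j, hj, hk⟩ | ⟨t', hpos, hk⟩
  · rw [Finset.sum_eq_single j]
    · exact mul_nonneg (by exact_mod_cast hj) (hp.1 j)
    · intro k _ hkj
      simp [hk k hkj]
    · simp
  · set κ : ℤ := ∑ k, (area t' * interp t k - area t * interp t' k) * pos (tri t v) k
    have hκ : (0 : ℝ) < κ := by exact_mod_cast hpos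
    have h1 : (κ : ℝ) * ∑ k, (bary t v k : ℝ) * p k =
        area t * (area t' * ∑ k, (interp t k : ℝ) * p k - area t * ∑ k, (interp t' k : ℝ) * p k) := by
      simp_rw [Finset.mul_sum, ← Finset.sum_sub_distrib, Finset.mul_sum]
      refine Finset.sum_congr rfl fun k _ => ?_
      have : (area t : ℝ) * (area t' * interp t k - area t * interp t' k) = κ * bary t v k := by
        exact_mod_cast hk k
      rw [← mul_assoc, ← this]
      ring
    have h2 := ht t'
    rw [div_le_div_iff₀ (ha t') (ha t)] at h2
    refine nonneg_of_mul_nonneg_right (a := (κ : ℝ)) ?_ hκ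
    rw [h1]
    refine mul_nonneg (ha t).le (sub_nonneg.2 ?_)
    linarith

theorem realize_surjOn {p : Fin 3 → ℝ} (hp : p ∈ stdSimplex ℝ (Fin 3)) :
    ∃ x ∈ disc, realize x = p := by
  obtain ⟨t, ht⟩ := exists_bary_nonneg hp
  have ha : (0 : ℝ) < area t := by exact_mod_cast area_pos t
  -- The barycentric coordinates of `p` in `t`; the factor `6` undoes the scaling of `pos`.
  set a : Fin 3 → ℝ := fun v => 6 * (∑ k, (bary t v k : ℝ) * p k) / area t with hadef
  have hreal : realize (onTri t a) = p := by
    ext j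
    rw [realize, sum_onTri_mul]
    have : ∑ v, a v * (pos (tri t v) j : ℝ) =
        6 / area t * ∑ k, p k * ((∑ v, bary t v k * pos (tri t v) j : ℤ) : ℝ) := by
      push_cast
      simp_rw [hadef, Finset.mul_sum, Finset.sum_div, Finset.sum_mul]
      rw [Finset.sum_comm]
      exact Finset.sum_congr rfl fun k _ => Finset.sum_congr rfl fun v _ => by ring
    rw [this]
    simp_rw [sum_pos_mul_bary]
    simp
    field_simp
  refine ⟨onTri t a, ⟨⟨fun i => ?_, ?_⟩, t, supportedOn_onTri t a⟩, hreal⟩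
  · refine Finset.sum_nonneg fun v _ => ?_
    split_ifs
    · exact div_nonneg (mul_nonneg (by norm_num) (ht v)) ha.le
    · exact le_rfl
  · rw [← sum_realize, hreal, hp.2]

theorem isCompact_disc : IsCompact disc := by
  have : disc = ⋃ t, (stdSimplex ℝ (Fin 14) ∩ ⋂ i, {x | (¬ ∃ v, tri t v = i) → x i = 0}) := by
    ext x
    simp only [disc, SupportedOn, Set.mem_ofPred_eq, Set.mem_iUnion, Set.mem_inter_iff,
      Set.mem_iInter]
    rw [← exists_and_left]
    refine exists_congr fun t => and_congr_right fun _ => forall_congr' fun i => ?_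
    rw [not_imp_comm]
  rw [this]
  refine isCompact_iUnion fun t => (isCompact_stdSimplex ℝ _).inter_right
    (isClosed_iInter fun i => ?_)
  by_cases h : ∃ v, tri t v = i
  · simp [h]
  · simp only [h, not_false_eq_true, true_imp_iff]
    exact isClosed_eq (continuous_apply i) continuous_const

noncomputable def discHomeo : disc ≃ₜ stdSimplex ℝ (Fin 3) :=
  haveI : CompactSpace disc := isCompact_iff_compactSpace.1 isCompact_disc
  Continuous.homeoOfEquivCompactToT2
    (f := Equiv.ofBijective (fun x : disc => (⟨realize x, realize_mem x.2.1⟩ : stdSimplex ℝ (Fin 3)))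
      ⟨fun x y h => Subtype.ext (realize_injOn x.2 y.2 (congrArg Subtype.val h)), fun p => by
        obtain ⟨x, hx, h⟩ := realize_surjOn p.2
        exact ⟨⟨x, hx⟩, Subtype.ext h⟩⟩)
    ((continuous_realize.comp continuous_subtype_val).subtype_mk _)

theorem coe_discHomeo (x : disc) : (discHomeo x : Fin 3 → ℝ) = realize x := rfl

end DunceHatTriangulation

namespace DunceHatTriangulation

open PreAbstractSimplicialComplex

/-! ### Gluing the disc to the Dunce Hat -/

/-- The map from the carrier of the disc to the carrier of the Dunce Hat. -/
noncomputable def glue (x : Fin 14 → ℝ) (j : Fin 8) : ℝ := ∑ i, x i * if label i = j then 1 else 0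

theorem continuous_glue : Continuous glue := by
  unfold glue
  fun_prop

theorem SupportedOn.glue_label {t : Fin 17} {x : Fin 14 → ℝ} (h : SupportedOn t x) (v : Fin 3) :
    glue x (label (tri t v)) = x (tri t v) := by
  rw [glue, h.sum_mul]
  simp [(label_tri_injective t).eq_iff]

theorem SupportedOn.exists_of_glue_ne_zero {t : Fin 17} {x : Fin 14 → ℝ} (h : SupportedOn t x)
    {j : Fin 8} (hj : glue x j ≠ 0) : ∃ v, label (tri t v) = j := by
  rw [glue, h.sum_mul] at hj
  obtain ⟨v, -, hv⟩ := Finset.exists_ne_zero_of_sum_ne_zero hj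
  refine ⟨v, ?_⟩
  by_contra hne
  simp [hne] at hv

theorem glue_mem {x : Fin 14 → ℝ} (hx : x ∈ disc) : glue x ∈ dunceHat.carrier := by
  obtain ⟨hx, t, ht⟩ := hx
  refine ⟨⟨fun j => ?_, ?_⟩, facet t, facet_mem t, fun j hj => ?_⟩
  · refine Finset.sum_nonneg fun i _ => mul_nonneg (hx.1 i) ?_
    split_ifs <;> norm_num
  · simp_rw [glue]
    rw [Finset.sum_comm]
    simp [hx.2]
  · obtain ⟨v, rfl⟩ := ht.exists_of_glue_ne_zero hj
    exact Finset.mem_coe.2 (Finset.mem_image_of_mem _ (Finset.mem_univ v))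

theorem glue_surjOn {y : Fin 8 → ℝ} (hy : y ∈ dunceHat.carrier) : ∃ x ∈ disc, glue x = y := by
  obtain ⟨hy, s, ⟨-, t, hst⟩, hs⟩ := hy
  set x := onTri t fun v => y (label (tri t v))
  have ht : SupportedOn t x := supportedOn_onTri t _
  have hglue : glue x = y := by
    ext j
    by_cases hj : ∃ v, label (tri t v) = j
    · obtain ⟨v, rfl⟩ := hj
      rw [ht.glue_label]
      exact onTri_tri t _ v
    · rw [not_not.1 (mt ht.exists_of_glue_ne_zero hj)]
      by_contra h0
      obtain ⟨v, -, hv⟩ := Finset.mem_image.1 (hst (hs (Ne.symm h0)))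
      exact hj ⟨v, hv⟩
  refine ⟨x, ⟨⟨fun i => Finset.sum_nonneg fun v _ => ?_, ?_⟩, t, ht⟩, hglue⟩
  · split_ifs
    exacts [hy.1 _, le_rfl]
  · rw [← hy.2, ← hglue]
    simp_rw [glue]
    rw [Finset.sum_comm]
    simp

/-- The boundary vertices of the disc along the edges `ab`, `bc` and `ac`. -/
def edgeVertex : Fin 3 → Fin 4 → Fin 14 := ![![0, 1, 2, 3], ![3, 4, 5, 6], ![0, 8, 7, 6]]

/-- The first endpoint of an edge of the triangle. -/
def edgeStart : Fin 3 → Fin 3 := ![0, 1, 0]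

/-- The second endpoint of an edge of the triangle. -/
def edgeEnd : Fin 3 → Fin 3 := ![1, 2, 2]

theorem pos_edgeVertex (e : Fin 3) (k : Fin 4) (j : Fin 3) : pos (edgeVertex e k) j =
    2 * ((3 - (k : ℕ)) * (if edgeStart e = j then 1 else 0) +
      (k : ℕ) * if edgeEnd e = j then 1 else 0) := by
  revert e k j
  decide +kernel

theorem label_edgeVertex (e : Fin 3) (k : Fin 4) : label (edgeVertex e k) = ![0, 1, 2, 0] k := by
  revert e k
  decide +kernel

theorem exists_tri_edge (e : Fin 3) (m : Fin 3) :
    ∃ t v w, tri t v = edgeVertex e m.castSucc ∧ tri t w = edgeVertex e m.succ := by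
  revert e m
  decide +kernel

/-- The points of the edges of the triangle. -/
noncomputable def edgePoint (e : Fin 3) (s : ℝ) (j : Fin 3) : ℝ :=
  (1 - s) * (if edgeStart e = j then 1 else 0) + s * if edgeEnd e = j then 1 else 0

theorem edgePoint_ab (s : ℝ) : edgePoint 0 s = ![1 - s, s, 0] := by
  ext j
  fin_cases j <;> simp [edgePoint, edgeStart, edgeEnd]

theorem edgePoint_bc (s : ℝ) : edgePoint 1 s = ![0, 1 - s, s] := by
  ext j
  fin_cases j <;> simp [edgePoint, edgeStart, edgeEnd]

theorem edgePoint_ac (s : ℝ) : edgePoint 2 s = ![1 - s, 0, s] := by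
  ext j
  fin_cases j <;> simp [edgePoint, edgeStart, edgeEnd]

/-- The piecewise linear function of `s` that is `1` at `k / 3` and vanishes at the other
multiples of `1 / 3`. -/
noncomputable def hat (k : Fin 4) (s : ℝ) : ℝ := max 0 (1 - |3 * s - (k : ℕ)|)

theorem exists_segment {s : ℝ} (h0 : 0 ≤ s) (h1 : s ≤ 1) :
    ∃ m : Fin 3, ((m : ℕ) : ℝ) ≤ 3 * s ∧ 3 * s ≤ (m : ℕ) + 1 := by
  rcases le_total (3 * s) 1 with h | h
  · exact ⟨0, by simpa using h0, by simpa using h⟩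
  · rcases le_total (3 * s) 2 with h' | h'
    · exact ⟨1, by simpa using h, by norm_num; linarith⟩
    · exact ⟨2, by simpa using h', by norm_num; linarith⟩

theorem hat_eq {s : ℝ} {m : Fin 3} (h0 : ((m : ℕ) : ℝ) ≤ 3 * s) (h1 : 3 * s ≤ (m : ℕ) + 1)
    (k : Fin 4) : hat k s = (if m.castSucc = k then (m : ℕ) + 1 - 3 * s else 0) +
      if m.succ = k then 3 * s - (m : ℕ) else 0 := by
  rw [hat]
  rcases lt_trichotomy (k : ℕ) m with h | h | h
  · have hc : ((k : ℕ) : ℝ) + 1 ≤ (m : ℕ) := by exact_mod_cast h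
    rw [if_neg (by rintro rfl; simp at h), if_neg (by rintro rfl; simp at h),
      abs_of_nonneg (by linarith), max_eq_left (by linarith), add_zero]
  · have hc : ((k : ℕ) : ℝ) = (m : ℕ) := by exact_mod_cast h
    rw [if_pos (Fin.ext (by simp [h])), if_neg (by rintro rfl; simp at h), hc,
      abs_of_nonneg (by linarith), max_eq_right (by linarith)]
    ring
  · rcases eq_or_ne (k : ℕ) (m + 1) with h' | h'
    · have hc : ((k : ℕ) : ℝ) = (m : ℕ) + 1 := by exact_mod_cast h'
      rw [if_neg (by rintro rfl; simp at h), if_pos (Fin.ext (by simp [h'])), hc,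
        abs_of_nonpos (by linarith), max_eq_right (by linarith)]
      ring
    · have hc : ((m : ℕ) : ℝ) + 2 ≤ (k : ℕ) := by
        exact_mod_cast (show (m : ℕ) + 2 ≤ k by omega)
      rw [if_neg (by rintro rfl; simp at h), if_neg (by rintro rfl; simp at h'),
        abs_of_nonpos (by linarith), max_eq_left (by linarith), add_zero]

/-- The point of the disc on an edge of the triangle. -/
noncomputable def edgeLift (e : Fin 3) (s : ℝ) (i : Fin 14) : ℝ :=
  ∑ k, if edgeVertex e k = i then hat k s else 0

theorem sum_edgeLift_mul (e : Fin 3) (s : ℝ) (g : Fin 14 → ℝ) :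
    ∑ i, edgeLift e s i * g i = ∑ k, hat k s * g (edgeVertex e k) := by
  simp_rw [edgeLift, Finset.sum_mul]
  rw [Finset.sum_comm]
  simp

theorem sum_hat_mul {s : ℝ} {m : Fin 3} (h0 : ((m : ℕ) : ℝ) ≤ 3 * s) (h1 : 3 * s ≤ (m : ℕ) + 1)
    (g : Fin 4 → ℝ) : ∑ k, hat k s * g k =
      ((m : ℕ) + 1 - 3 * s) * g m.castSucc + (3 * s - (m : ℕ)) * g m.succ := by
  simp_rw [hat_eq h0 h1, add_mul, Finset.sum_add_distrib]
  simp

theorem edgeLift_mem (e : Fin 3) {s : ℝ} (h0 : 0 ≤ s) (h1 : s ≤ 1) : edgeLift e s ∈ disc := by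
  obtain ⟨m, hm0, hm1⟩ := exists_segment h0 h1
  refine ⟨⟨fun i => Finset.sum_nonneg fun k _ => ?_, ?_⟩, ?_⟩
  · split_ifs
    exacts [le_max_left _ _, le_rfl]
  · have := sum_edgeLift_mul e s fun _ => 1
    rw [sum_hat_mul hm0 hm1] at this
    simp only [mul_one] at this
    rw [this]
    ring
  · obtain ⟨t, v, w, hv, hw⟩ := exists_tri_edge e m
    refine ⟨t, fun i hi => ?_⟩
    obtain ⟨k, -, hk⟩ := Finset.exists_ne_zero_of_sum_ne_zero hi
    obtain ⟨rfl, hk⟩ := ite_ne_right_iff.1 hk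
    rw [hat_eq hm0 hm1] at hk
    by_cases h : m.castSucc = k
    · exact ⟨v, h ▸ hv⟩
    · by_cases h' : m.succ = k
      · exact ⟨w, h' ▸ hw⟩
      · simp [h, h'] at hk

theorem realize_edgeLift (e : Fin 3) {s : ℝ} (h0 : 0 ≤ s) (h1 : s ≤ 1) :
    realize (edgeLift e s) = edgePoint e s := by
  obtain ⟨m, hm0, hm1⟩ := exists_segment h0 h1
  ext j
  rw [realize, sum_edgeLift_mul, sum_hat_mul hm0 hm1 fun k => (pos (edgeVertex e k) j : ℝ),
    pos_edgeVertex, pos_edgeVertex, edgePoint]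
  push_cast
  simp only [Fin.val_castSucc, Fin.val_succ]
  push_cast
  ring

/-- The common image of the three edges in the carrier of the Dunce Hat. -/
noncomputable def loop (s : ℝ) (j : Fin 8) : ℝ :=
  ∑ k, hat k s * if ![(0 : Fin 8), 1, 2, 0] k = j then 1 else 0

theorem glue_edgeLift (e : Fin 3) (s : ℝ) : glue (edgeLift e s) = loop s := by
  ext j
  rw [glue, sum_edgeLift_mul]
  simp_rw [label_edgeVertex]
  rfl

/-- The coordinates `1` and `2` are single tent functions; together they determine `s`, except that
both vanish at the two ends. -/
theorem loop_inj {s s' : ℝ} (h0 : 0 ≤ s) (h1 : s ≤ 1) (h0' : 0 ≤ s') (h1' : s' ≤ 1)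
    (h : loop s = loop s') : s = s' ∨ (s = 0 ∧ s' = 1) ∨ (s = 1 ∧ s' = 0) := by
  have e1 : hat 1 s = hat 1 s' := by simpa [loop, Fin.sum_univ_four] using congrFun h 1
  have e2 : hat 2 s = hat 2 s' := by simpa [loop, Fin.sum_univ_four] using congrFun h 2
  obtain ⟨m, hm0, hm1⟩ := exists_segment h0 h1
  obtain ⟨m', hm0', hm1'⟩ := exists_segment h0' h1'
  rw [hat_eq hm0 hm1, hat_eq hm0' hm1'] at e1 e2
  fin_cases m <;> fin_cases m' <;> norm_num [Fin.ext_iff] at e1 e2 hm0 hm1 hm0' hm1' <;>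
    first
      | exact .inl (by linarith)
      | exact .inr (.inl ⟨by linarith, by linarith⟩)
      | exact .inr (.inr ⟨by linarith, by linarith⟩)

/-- No triangle cuts across the disc between boundary vertices, so a point involving only boundary
vertices lies on the boundary. -/
theorem exists_boundary_segment (t : Fin 17) : ∃ e m : Fin 3, ∀ v, (tri t v : ℕ) < 9 →
    tri t v = edgeVertex e m.castSucc ∨ tri t v = edgeVertex e m.succ := by
  revert t
  decide +kernel

theorem edgeVertex_castSucc_ne_succ (e m : Fin 3) :
    edgeVertex e m.castSucc ≠ edgeVertex e m.succ := by
  revert e m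
  decide +kernel

/-- A point of the disc that involves no interior vertex is on an edge. -/
theorem exists_eq_edgeLift {x : Fin 14 → ℝ} (hx : x ∈ disc) (h : ∀ i : Fin 14, 9 ≤ (i : ℕ) → x i = 0) :
    ∃ e s, 0 ≤ s ∧ s ≤ 1 ∧ x = edgeLift e s := by
  obtain ⟨t, ht⟩ := hx.2
  obtain ⟨e, m, hem⟩ := exists_boundary_segment t
  set u := edgeVertex e m.castSucc with hu
  set w := edgeVertex e m.succ with hw
  have huw : u ≠ w := edgeVertex_castSucc_ne_succ e m
  have hsupp : ∀ i, i ≠ u ∧ i ≠ w → x i = 0 := fun i hi => by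
    by_contra h0
    obtain ⟨v, rfl⟩ := ht i h0
    rcases lt_or_ge (tri t v : ℕ) 9 with h9 | h9
    · rcases hem v h9 with h' | h'
      exacts [hi.1 h', hi.2 h']
    · exact h0 (h _ h9)
  have hsum : ∀ g : Fin 14 → ℝ, ∑ i, x i * g i = x u * g u + x w * g w := fun g =>
    Fintype.sum_eq_add u w huw fun i hi => by rw [hsupp i hi, zero_mul]
  have h1 : x u + x w = 1 := by
    have := hsum fun _ => 1
    simp only [mul_one] at this
    rw [← this, hx.1.2]
  have hu0 := hx.1.1 u
  have hw0 := hx.1.1 w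
  have hm : ((m : ℕ) : ℝ) ≤ 2 := by exact_mod_cast (show (m : ℕ) ≤ 2 by omega)
  have hs0 : 0 ≤ ((m : ℕ) + x w) / 3 := by positivity
  have hs1 : ((m : ℕ) + x w) / 3 ≤ 1 := by linarith
  -- The point lies in the `m`-th third of the edge, at fraction `x w` of the way; injectivity of
  -- `realize` reduces the claim to the triangle.
  refine ⟨e, ((m : ℕ) + x w) / 3, hs0, hs1, realize_injOn hx (edgeLift_mem e hs0 hs1) ?_⟩
  rw [realize_edgeLift e hs0 hs1]
  ext j
  rw [realize, hsum, hu, hw, pos_edgeVertex, pos_edgeVertex, edgePoint, ← hu, ← hw,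
    show x u = 1 - x w by linarith]
  push_cast
  simp only [Fin.val_castSucc, Fin.val_succ]
  push_cast
  ring

/-- Gluing never identifies distinct vertices of triangles that share an interior vertex; this makes
it injective off the boundary. -/
theorem eq_of_label_eq_of_interior : ∀ t t' v v', 9 ≤ (tri t v : ℕ) → tri t v = tri t' v' →
    ∀ w w', label (tri t w) = label (tri t' w') → tri t w = tri t' w' := by
  decide +kernel

theorem eq_of_label_eq : ∀ i i' : Fin 14, 9 ≤ (i : ℕ) → label i' = label i → i' = i := by
  decide +kernel

theorem glue_of_interior (x : Fin 14 → ℝ) {i : Fin 14} (hi : 9 ≤ (i : ℕ)) :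
    glue x (label i) = x i := by
  rw [glue, Finset.sum_eq_single i]
  · simp
  · intro i' _ hne
    rw [if_neg fun h => hne (eq_of_label_eq i i' hi h), mul_zero]
  · simp

/-- Away from the boundary, gluing is injective. -/
theorem eq_of_glue_eq {x y : Fin 14 → ℝ} (hx : x ∈ disc) (hy : y ∈ disc) (h : glue x = glue y)
    {i : Fin 14} (hi : 9 ≤ (i : ℕ)) (hxi : x i ≠ 0) : x = y := by
  obtain ⟨-, t, ht⟩ := hx
  obtain ⟨-, t', ht'⟩ := hy
  have hyi : y i ≠ 0 := by rwa [← glue_of_interior y hi, ← h, glue_of_interior x hi]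
  obtain ⟨v, hv⟩ := ht i hxi
  obtain ⟨v', hv'⟩ := ht' i hyi
  have hsame : ∀ w w', label (tri t w) = label (tri t' w') → tri t w = tri t' w' :=
    eq_of_label_eq_of_interior t t' v v' (by rwa [hv]) (hv.trans hv'.symm)
  have key : ∀ {t t' : Fin 17} {x y : Fin 14 → ℝ}, SupportedOn t x → SupportedOn t' y →
      glue x = glue y →
      (∀ w w', label (tri t w) = label (tri t' w') → tri t w = tri t' w') →
      ∀ i, x i ≠ 0 → x i = y i := by
    intro t t' x y ht ht' h hsame i hxi
    obtain ⟨w, rfl⟩ := ht i hxi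
    rw [← ht.glue_label, h] at hxi ⊢
    obtain ⟨w', hw'⟩ := ht'.exists_of_glue_ne_zero hxi
    rw [hsame w w' hw'.symm, ht'.glue_label]
  ext j
  by_cases hxj : x j = 0
  · by_cases hyj : y j = 0
    · rw [hxj, hyj]
    · exact (key ht' ht h.symm (fun w w' e => (hsame w' w e.symm).symm) j hyj).symm
  · exact key ht ht' h hsame j hxj

theorem quot_edgePoint (e : Fin 3) (s : ℝ) (p q : stdSimplex ℝ (Fin 3))
    (hp : (p : Fin 3 → ℝ) = edgePoint e s) (hq : (q : Fin 3 → ℝ) = edgePoint 0 s) :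
    (Quot.mk DunceHatRel p) = Quot.mk DunceHatRel q := by
  rw [edgePoint_ab] at hq
  match e with
  | 0 => rw [Subtype.ext (hp.trans ((edgePoint_ab s).trans hq.symm))]
  | 1 => exact (Quot.sound (.ab_bc s q p hq (hp.trans (edgePoint_bc s)))).symm
  | 2 => exact (Quot.sound (.ab_ac s q p hq (hp.trans (edgePoint_ac s)))).symm

theorem edgePoint_mem (e : Fin 3) {s : ℝ} (h0 : 0 ≤ s) (h1 : s ≤ 1) :
    edgePoint e s ∈ stdSimplex ℝ (Fin 3) :=
  realize_edgeLift e h0 h1 ▸ realize_mem (edgeLift_mem e h0 h1).1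

/-- The corner `b` both ends `ab` and starts `bc`, so identifying the starting points of the edges
identifies it with `a`. -/
theorem quot_endpoints (p q : stdSimplex ℝ (Fin 3)) (hp : (p : Fin 3 → ℝ) = edgePoint 0 0)
    (hq : (q : Fin 3 → ℝ) = edgePoint 0 1) :
    (Quot.mk DunceHatRel p) = Quot.mk DunceHatRel q :=
  (quot_edgePoint 1 0 q p (by rw [hq, edgePoint_ab, edgePoint_bc]; simp) hp).symm

/-- A point involving an interior vertex is determined by its image. Otherwise both points lie on
edges and can be moved to `ab`, where `loop_inj` leaves only equal parameters or the two ends. -/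
theorem quot_realize_eq (x y : disc) (h : glue x = glue y) :
    Quot.mk DunceHatRel (discHomeo x) = Quot.mk DunceHatRel (discHomeo y) := by
  by_cases hx : ∃ i : Fin 14, 9 ≤ (i : ℕ) ∧ (x : Fin 14 → ℝ) i ≠ 0
  · obtain ⟨i, hi, hxi⟩ := hx
    rw [Subtype.ext (eq_of_glue_eq x.2 y.2 h hi hxi)]
  by_cases hy : ∃ i : Fin 14, 9 ≤ (i : ℕ) ∧ (y : Fin 14 → ℝ) i ≠ 0
  · obtain ⟨i, hi, hyi⟩ := hy
    rw [Subtype.ext (eq_of_glue_eq y.2 x.2 h.symm hi hyi)]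
  push Not at hx hy
  obtain ⟨e, s, h0, h1, hes⟩ := exists_eq_edgeLift x.2 hx
  obtain ⟨e', s', h0', h1', hes'⟩ := exists_eq_edgeLift y.2 hy
  rw [hes, hes', glue_edgeLift, glue_edgeLift] at h
  have hp : (discHomeo x : Fin 3 → ℝ) = edgePoint e s := by
    rw [coe_discHomeo, hes, realize_edgeLift e h0 h1]
  have hq : (discHomeo y : Fin 3 → ℝ) = edgePoint e' s' := by
    rw [coe_discHomeo, hes', realize_edgeLift e' h0' h1']
  rw [quot_edgePoint e s _ ⟨edgePoint 0 s, edgePoint_mem 0 h0 h1⟩ hp rfl,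
    quot_edgePoint e' s' _ ⟨edgePoint 0 s', edgePoint_mem 0 h0' h1'⟩ hq rfl]
  rcases loop_inj h0 h1 h0' h1' h with rfl | ⟨rfl, rfl⟩ | ⟨rfl, rfl⟩
  · rfl
  · exact quot_endpoints _ _ rfl rfl
  · exact (quot_endpoints _ _ rfl rfl).symm

/-- The map from the triangle to the carrier of the triangulated Dunce Hat. -/
noncomputable def toCarrier (p : stdSimplex ℝ (Fin 3)) : dunceHat.carrier :=
  ⟨glue (discHomeo.symm p : disc), glue_mem (discHomeo.symm p).2⟩

theorem continuous_toCarrier : Continuous toCarrier :=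
  (continuous_glue.comp (continuous_subtype_val.comp discHomeo.symm.continuous)).subtype_mk _

theorem toCarrier_edgePoint (e : Fin 3) {s : ℝ} {p : stdSimplex ℝ (Fin 3)}
    (hp : (p : Fin 3 → ℝ) = edgePoint e s) : (toCarrier p : Fin 8 → ℝ) = loop s := by
  have hse : ∀ e, edgeStart e ≠ edgeEnd e := by decide
  have hmem : edgePoint e s ∈ stdSimplex ℝ (Fin 3) := hp ▸ p.2
  have h0 : 0 ≤ s := by simpa [edgePoint, hse e] using hmem.1 (edgeEnd e)
  have h1 : s ≤ 1 := by simpa [edgePoint, (hse e).symm] using hmem.1 (edgeStart e)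
  have heq : discHomeo.symm p = ⟨edgeLift e s, edgeLift_mem e h0 h1⟩ := by
    rw [Homeomorph.symm_apply_eq]
    exact Subtype.ext (hp.trans (realize_edgeLift e h0 h1).symm)
  change glue (discHomeo.symm p : disc) = loop s
  rw [heq]
  exact glue_edgeLift e s

theorem toCarrier_eq_of_rel (p q : stdSimplex ℝ (Fin 3)) (h : DunceHatRel p q) :
    toCarrier p = toCarrier q := by
  refine Subtype.ext ?_
  cases h with
  | ab_bc t _ _ hp hq =>
    rw [toCarrier_edgePoint 0 (hp.trans (edgePoint_ab t).symm),
      toCarrier_edgePoint 1 (hq.trans (edgePoint_bc t).symm)]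
  | ab_ac t _ _ hp hq =>
    rw [toCarrier_edgePoint 0 (hp.trans (edgePoint_ab t).symm),
      toCarrier_edgePoint 2 (hq.trans (edgePoint_ac t).symm)]

theorem bijective_quotLift :
    Function.Bijective (Quot.lift toCarrier toCarrier_eq_of_rel : DunceHat → dunceHat.carrier) := by
  constructor
  · rintro ⟨p⟩ ⟨q⟩ h
    have := quot_realize_eq (discHomeo.symm p) (discHomeo.symm q) (congrArg Subtype.val h)
    simpa using this
  · rintro ⟨y, hy⟩
    obtain ⟨x, hx, rfl⟩ := glue_surjOn hy
    refine ⟨Quot.mk _ (discHomeo ⟨x, hx⟩), Subtype.ext ?_⟩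
    change glue (discHomeo.symm (discHomeo ⟨x, hx⟩) : disc) = glue x
    rw [Homeomorph.symm_apply_apply]

/-- The quotient is compact and the carrier Hausdorff, so the continuous bijection is a
homeomorphism. -/
theorem triangulates_dunceHat : dunceHat.Triangulates DunceHat := by
  have : CompactSpace (stdSimplex ℝ (Fin 3)) :=
    isCompact_iff_compactSpace.1 (isCompact_stdSimplex ℝ _)
  exact ⟨(Continuous.homeoOfEquivCompactToT2 (f := Equiv.ofBijective _ bijective_quotLift)
    (continuous_quot_lift _ continuous_toCarrier)).symm⟩

end DunceHatTriangulation

theorem theorem1 :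
    (∀ (V : Type*) [DecidableEq V] (K : PreAbstractSimplicialComplex V),
      K.faces.Nonempty → K.vertexSet.encard ≤ 7 → K.IsAcyclic → K.IsCollapsible) ∧
    (∃ K : PreAbstractSimplicialComplex (Fin 8),
      K.vertexSet.encard = 8 ∧ K.Triangulates DunceHat ∧ K.IsAcyclic ∧ ¬ K.IsCollapsible) := by
  refine ⟨fun V _ K hne hcard hK => hK.isCollapsible hne hcard, ?_⟩
  exact ⟨DunceHatTriangulation.dunceHat, DunceHatTriangulation.encard_vertexSet_dunceHat,
    DunceHatTriangulation.triangulates_dunceHat, DunceHatTriangulation.isAcyclic_dunceHat,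
    DunceHatTriangulation.not_isCollapsible_dunceHat⟩
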